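/- **Conventions.** A *C\*-category* is a category $\mathcal C$ whose hom-sets $\mathcal C_{AB}:=\mathrm{Hom}(B,A)$ are complex Banach spaces, with bilinear composition and an identity-on-objects involutive antilinear contravariant functor $*$, such that $\|xy\|\le\|x\|\|y\|$, $\|x^*x\|=\|x\|^2$, and for every $x\in\mathcal C_{BA}$ there is $y\in\mathcal C_{AA}$ with $x^*x=y^*y$. It is *commutative* if all the algebras $\mathcal C_{AA}$ are commutative, and *full* if for all $A,B$ the products $x^*y$ ($x,y\in\mathcal C_{AB}$) span a dense subspace of $\mathcal C_{BB}$ and the products $xy^*$ a dense subspace of $\mathcal C_{AA}$. Let $\mathscr A$ be the category of small commutative full C\*-categories with nonempty set of objects; its morphisms are the object-bijective $*$-functors (functors that are linear on hom-sets, preserve $*$, and are bijective on objects). For a compact Hausdorff space $X$ and a nonempty set $\mathcal O$, let $\Delta_X=\{(p,p):p\in X\}$ and let $\mathcal R_{\mathcal O}=\mathcal O\times\mathcal O$ (discrete), regarded as involutive categories (equivalence relations). Write $p_{AB}=((p,p),(A,B))\in\Delta_X\times\mathcal R_{\mathcal O}$. A *topological spaceoid* $(\mathcal E,\pi,\Delta_X\times\mathcal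 R_{\mathcal O})$ is a saturated unital rank-one Fell bundle over $\Delta_X\times\mathcal R_{\mathcal O}$: a locally trivial complex line bundle with Banach norms on the fibres depending continuously on the point of the total space; continuous bilinear associative products $\mathcal E_{p_{AB}}\times\mathcal E_{p_{BC}}\to\mathcal E_{p_{AC}}$ with $\|ef\|\le\|e\|\|f\|$; a continuous conjugate-linear involution $\mathcal E_{p_{AB}}\to\mathcal E_{p_{BA}}$ with $e^{**}=e$, $(ef)^*=f^*e^*$, $\|e^*e\|=\|e\|^2$ and $e^*e\ge0$ (that is, for $e\in\mathcal E_{p_{AB}}$, $e^*e=f^*f$ for some $f\in\mathcal E_{p_{BB}}$); units $1\in\mathcal E_{p_{AA}}$; and every $\mathcal E_{p_{AB}}$ is a full Hilbert C\*-bimodule over $\mathcal E_{p_{AA}}$ and $\mathcal E_{p_{BB}}$. A *morphism* $(f,\mathcal F):\mathcal E_1\to\mathcal E_2$ consists of a continuous map $f_\Delta:X_1\to X_2$, an isomorphism $f_{\mathcal R}:\mathcal R_{\mathcal O_1}\to\mathcal R_{\mathcal O_2}$ of equivalence relations (induced by a bijection $\mathcal O_1\to\mathcal O_2$), and a continuous,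 fibrewise linear (identity-preserving) $*$-functor $\mathcal F:f^\bullet(\mathcal E_2)\to\mathcal E_1$ over $\Delta_{X_1}\times\mathcal R_{\mathcal O_1}$, where $f=(f_\Delta,f_{\mathcal R})$ and $f^\bullet$ denotes the pull-back. Composition is $(g,\mathcal G)\circ(f,\mathcal F)=(g\circ f,\mathcal F\circ f^\bullet(\mathcal G))$. Let $\mathscr T$ be the category of spaceoids. **Sections.** For a spaceoid $\mathcal E$, $\Gamma(\mathcal E)$ has object set $\mathcal O$; $\Gamma(\mathcal E)_{AB}$ is the set of continuous sections $\sigma:p\mapsto\sigma_p\in\mathcal E_{p_{AB}}$, with pointwise operations and norm $\sup_p\|\sigma_p\|$. For $(f,\mathcal F):\mathcal E_1\to\mathcal E_2$, the functor $\Gamma_{(f,\mathcal F)}:\Gamma(\mathcal E_2)\to\Gamma(\mathcal E_1)$ is $\sigma\mapsto\mathcal F\circ f^\bullet(\sigma)$ (and the inverse of the bijection underlying $f_{\mathcal R}$ on objects). **Spectrum.** For $\mathcal C\in\mathscr A$, let $[\mathcal C;\mathbb C]$ be the set of $\mathbb C$-valued $*$-functors on $\mathcal C$ with the weakest topology making all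 evaluations continuous, and let $\mathrm{Sp}_b(\mathcal C)$ be its quotient space by unitary equivalence ($\omega_1\sim\omega_2$ iff there are $\nu_A\in\mathbb T$ with $\nu_A\omega_1(x)=\omega_2(x)\nu_B$ for all $x\in\mathcal C_{AB}$). Put $I_{[\omega]_{AB}}=\{x\in\mathcal C_{AB}:\omega(x)=0\}$. $\Sigma(\mathcal C)$ is the bundle over $\Delta_{\mathrm{Sp}_b(\mathcal C)}\times\mathcal R_{\mathrm{Ob}\,\mathcal C}$ with fibres $\mathcal C_{AB}/I_{[\omega]_{AB}}$, with the quotient norms and the product and involution induced by $\mathcal C$; its topology is generated by the tubes $\{e\in\mathcal C_{AB}/I_{[\omega]_{AB}}:[\omega]\in U,\ \|e-(x+I_{[\omega]_{AB}})\|<\varepsilon\}$, for $A,B\in\mathrm{Ob}\,\mathcal C$, $x\in\mathcal C_{AB}$, $U\subseteq\mathrm{Sp}_b(\mathcal C)$ open and $\varepsilon>0$. For $\Phi:\mathcal C\to\mathcal D$ in $\mathscr A$, $\Sigma^\Phi=(\lambda^\Phi,\Lambda^\Phi):\Sigma(\mathcal D)\to\Sigma(\mathcal C)$ is given by $\lambda^\Phi_\Delta[\omega]=[\omega\circ\Phi]$,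 $\lambda^\Phi_{\mathcal R}(A,B)=(\Phi_o^{-1}(A),\Phi_o^{-1}(B))$, where $\Phi_o$ is the object map of $\Phi$, and $\Lambda^\Phi:x+I_{\lambda^\Phi([\omega]_{AB})}\mapsto\Phi(x)+I_{[\omega]_{AB}}$. **Theorem** (P. Bertozzini–R. Conti–W. Lewkeeratiyutkul). 1. $\Gamma$ is a contravariant functor $\mathscr T\to\mathscr A$: each $\Gamma(\mathcal E)$ is a commutative full C\*-category, each $\Gamma_{(f,\mathcal F)}$ is an object-bijective $*$-functor, and identities and compositions are respected. 2. $\Sigma$ is a contravariant functor $\mathscr A\to\mathscr T$: each $\Sigma(\mathcal C)$ is a topological spaceoid (in particular $\mathrm{Sp}_b(\mathcal C)$ is compact Hausdorff), each $\Sigma^\Phi$ is a morphism of spaceoids, and identities and compositions are respected. 3. The Gel'fand transforms $\mathfrak G_{\mathcal C}:\mathcal C\to\Gamma(\Sigma(\mathcal C))$, the identity on objects and $x\mapsto\hat x$ with $\hat x_{[\omega]}=x+I_{[\omega]_{AB}}$ for $x\in\mathcal C_{AB}$, form a natural isomorphism $\mathrm{Id}_{\mathscr A}\to\Gamma\circ\Sigma$;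 each $\mathfrak G_{\mathcal C}$ is isometric and full. 4. The evaluation transforms $\mathfrak E_{\mathcal E}=(\eta,\Omega):\mathcal E\to\Sigma(\Gamma(\mathcal E))$ form a natural isomorphism $\mathrm{Id}_{\mathscr T}\to\Sigma\circ\Gamma$. Here $\eta_{\mathcal R}(A,B)=(A,B)$; $\eta_\Delta(p)=[\gamma\circ\mathrm{ev}_p]$, where $\mathrm{ev}_p(\sigma)=\sigma_p$ and $\gamma$ is a $\mathbb C$-valued $*$-functor on the C\*-category with object set $\mathcal O$ and hom-spaces $\mathcal E_{p_{AB}}$ (such a $\gamma$ exists, and the class does not depend on its choice); and $\Omega(p_{AB},\sigma+I_{\eta(p_{AB})})=\sigma_p$ for $\sigma\in\Gamma(\mathcal E)_{AB}$. 5. $\mathfrak G$ and $\mathfrak E$ satisfy the triangle identities $\Gamma(\mathfrak E_{\mathcal E})\circ\mathfrak G_{\Gamma(\mathcal E)}=\mathrm{id}$ and $\Sigma(\mathfrak G_{\mathcal C})\circ\mathfrak E_{\Sigma(\mathcal C)}=\mathrm{id}$. Hence $(\Gamma,\Sigma)$ is a duality (contravariant equivalence) between $\mathscr T$ and $\mathscr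 A$. -/

import Mathlib

open CategoryTheory Bundle Opposite
open scoped ComplexConjugate

universe u

namespace GelfandSpaceoid

noncomputable section

/-! ## Small commutative full C*-categories -/

/-- The data of a small C*-category: a small category whose hom-sets are normed complex vector
spaces, with a map `adj` reversing the arrows.  The axioms are in `IsCStarCat`.
In the notation `C_{AB} = Hom(B, A)`, an element of `C_{AB}` is an arrow `B ⟶ A`, and the product
`x ∘ y` of `x ∈ C_{AB}` and `y ∈ C_{BD}` is `y ≫ x`. -/
structure StarCatData where
  Obj : Type u
  [category : SmallCategory Obj]
  [normedGroup : ∀ A B : Obj, NormedAddCommGroup (A ⟶ B)]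
  [normedSpace : ∀ A B : Obj, NormedSpace ℂ (A ⟶ B)]
  adj : ∀ {A B : Obj}, (A ⟶ B) → (B ⟶ A)

attribute [instance] StarCatData.category StarCatData.normedGroup StarCatData.normedSpace

/-- The axioms of a C*-category. -/
structure IsCStarCat (C : StarCatData.{u}) : Prop where
  complete : ∀ A B : C.Obj, CompleteSpace (A ⟶ B)
  add_comp : ∀ {A B D : C.Obj} (x y : A ⟶ B) (z : B ⟶ D), (x + y) ≫ z = x ≫ z + y ≫ z
  comp_add : ∀ {A B D : C.Obj} (x : A ⟶ B) (y z : B ⟶ D), x ≫ (y + z) = x ≫ y + x ≫ z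
  smul_comp : ∀ {A B D : C.Obj} (c : ℂ) (x : A ⟶ B) (z : B ⟶ D), (c • x) ≫ z = c • (x ≫ z)
  comp_smul : ∀ {A B D : C.Obj} (c : ℂ) (x : A ⟶ B) (z : B ⟶ D), x ≫ (c • z) = c • (x ≫ z)
  adj_add : ∀ {A B : C.Obj} (x y : A ⟶ B), C.adj (x + y) = C.adj x + C.adj y
  adj_smul : ∀ {A B : C.Obj} (c : ℂ) (x : A ⟶ B), C.adj (c • x) = conj c • C.adj x
  adj_adj : ∀ {A B : C.Obj} (x : A ⟶ B), C.adj (C.adj x) = x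
  adj_id : ∀ A : C.Obj, C.adj (𝟙 A) = 𝟙 A
  adj_comp : ∀ {A B D : C.Obj} (x : A ⟶ B) (y : B ⟶ D), C.adj (x ≫ y) = C.adj y ≫ C.adj x
  norm_comp_le : ∀ {A B D : C.Obj} (x : A ⟶ B) (y : B ⟶ D), ‖x ≫ y‖ ≤ ‖x‖ * ‖y‖
  norm_comp_adj : ∀ {A B : C.Obj} (x : A ⟶ B), ‖x ≫ C.adj x‖ = ‖x‖ ^ 2
  /-- `x* x` is a positive element of the algebra of endomorphisms of the source of `x`. -/
  positive : ∀ {A B : C.Obj} (x : A ⟶ B), ∃ y : A ⟶ A, x ≫ C.adj x = y ≫ C.adj y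

/-- A C*-category is commutative if the algebras `C_{AA}` are. -/
def IsCommutativeCat (C : StarCatData.{u}) : Prop :=
  ∀ (A : C.Obj) (x y : A ⟶ A), x ≫ y = y ≫ x

/-- A C*-category is full if all the Hilbert C*-bimodules `C_{AB}` are full: the inner products
`x* y` span a dense subspace of `C_{BB}`, and the inner products `x y*` one of `C_{AA}`. -/
def IsFullCat (C : StarCatData.{u}) : Prop :=
  ∀ A B : C.Obj,
    Dense (Submodule.span ℂ {z : B ⟶ B | ∃ x y : B ⟶ A, z = y ≫ C.adj x} : Set (B ⟶ B)) ∧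
    Dense (Submodule.span ℂ {z : A ⟶ A | ∃ x y : B ⟶ A, z = C.adj y ≫ x} : Set (A ⟶ A))

/-- The axioms of a (nonempty) commutative full C*-category. -/
structure IsFullCommCStarCat (C : StarCatData.{u}) : Prop where
  nonempty : Nonempty C.Obj
  isCStarCat : IsCStarCat C
  isCommutative : IsCommutativeCat C
  isFull : IsFullCat C

/-- Small commutative full C*-categories with a nonempty set of objects. -/
structure FullCommCStarCat extends StarCatData.{u} where
  property : IsFullCommCStarCat toStarCatData

/-- A functor is an object-bijective *-functor if it is `ℂ`-linear on the hom-sets, compatible with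
the involutions, and bijective on the objects. -/
structure IsObjBijStarFunctor {C D : StarCatData.{u}} (F : C.Obj ⥤ D.Obj) : Prop where
  map_add : ∀ {A B : C.Obj} (x y : A ⟶ B), F.map (x + y) = F.map x + F.map y
  map_smul : ∀ {A B : C.Obj} (c : ℂ) (x : A ⟶ B), F.map (c • x) = c • F.map x
  map_adj : ∀ {A B : C.Obj} (x : A ⟶ B), F.map (C.adj x) = D.adj (F.map x)
  bijective : Function.Bijective F.obj

/-- Object-bijective *-functors. -/
@[ext]
structure ObjBijStarFunctor (C D : StarCatData.{u}) where
  functor : C.Obj ⥤ D.Obj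
  property : IsObjBijStarFunctor functor

/-- The category of object-bijective *-functors between small commutative full C*-categories. -/
instance : Category FullCommCStarCat.{u} where
  Hom C D := ObjBijStarFunctor C.toStarCatData D.toStarCatData
  id C := ⟨𝟭 _, ⟨fun _ _ => rfl, fun _ _ => rfl, fun _ => rfl, Function.bijective_id⟩⟩
  comp F G := ⟨F.functor ⋙ G.functor,
    { map_add := fun x y => by simp [F.property.map_add, G.property.map_add]
      map_smul := fun c x => by simp [F.property.map_smul, G.property.map_smul]
      map_adj := fun x => by simp [F.property.map_adj, G.property.map_adj]
      bijective := G.property.bijective.comp F.property.bijective }⟩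

/-! ## Topological spaceoids -/

/-- The data of a rank-one Fell bundle over `Δ_X × R_O`, with `X = Base` and `O = Ind`.
The fibre over the point `p_{AB} = ((p, p), (A, B))` is `Fib A B p`.  As `R_O` is discrete, the
total space is the topological disjoint union of its restrictions to the clopen subspaces
`Δ_X × {(A, B)} ≃ X` of the base; the topology is given on each of these restrictions.
Since `((p, p), (A, B)) ∘ ((p, p), (B, C)) = ((p, p), (A, C))` and
`((p, p), (A, B))* = ((p, p), (B, A))` are the only products and adjoints in the base, the
multiplication and the involution are the maps `mul` and `adj` between fibres.
The axioms are in `IsSpaceoid`. -/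
structure SpaceoidData where
  Base : Type u
  Ind : Type u
  Fib : Ind → Ind → Base → Type u
  [topBase : TopologicalSpace Base]
  [normedGroup : ∀ A B p, NormedAddCommGroup (Fib A B p)]
  [normedSpace : ∀ A B p, NormedSpace ℂ (Fib A B p)]
  [topTotal : ∀ A B, TopologicalSpace (TotalSpace ℂ (Fib A B))]
  mul : ∀ {A B C : Ind} {p : Base}, Fib A B p → Fib B C p → Fib A C p
  adj : ∀ {A B : Ind} {p : Base}, Fib A B p → Fib B A p
  one : ∀ (A : Ind) (p : Base), Fib A A p

attribute [instance] SpaceoidData.topBase SpaceoidData.normedGroup SpaceoidData.normedSpace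
  SpaceoidData.topTotal

/-- The restriction of the total space to `Δ_X × {(A, B)}`. -/
abbrev SpaceoidData.Tot (E : SpaceoidData.{u}) (A B : E.Ind) : Type u :=
  TotalSpace ℂ (E.Fib A B)

/-- The axioms of a topological spaceoid, i.e. a saturated unital rank-one Fell bundle over
`Δ_X × R_O`, with `X` compact Hausdorff and `O` nonempty. -/
structure IsSpaceoid (E : SpaceoidData.{u}) : Prop where
  compact : CompactSpace E.Base
  hausdorff : T2Space E.Base
  nonempty : Nonempty E.Ind
  /-- The bundle is a rank-one complex vector bundle. -/
  rank_one : ∀ (A B : E.Ind) (p : E.Base), Module.finrank ℂ (E.Fib A B p) = 1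
  locally_trivial : ∀ (A B : E.Ind) (p : E.Base),
    ∃ e : Trivialization ℂ (TotalSpace.proj : E.Tot A B → E.Base),
      p ∈ e.baseSet ∧ e.IsLinear ℂ
  /-- The bundle is a Banach bundle: complete fibres and a continuous norm. -/
  complete : ∀ (A B : E.Ind) (p : E.Base), CompleteSpace (E.Fib A B p)
  continuous_norm : ∀ A B : E.Ind, Continuous fun e : E.Tot A B => ‖e.2‖
  /-- Multiplication and involution are continuous. -/
  continuous_mul : ∀ A B C : E.Ind,
    Continuous fun z : TotalSpace (ℂ × ℂ) (E.Fib A B ×ᵇ E.Fib B C) =>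
      (⟨z.1, E.mul z.2.1 z.2.2⟩ : E.Tot A C)
  continuous_adj : ∀ A B : E.Ind,
    Continuous fun e : E.Tot A B => (⟨e.1, E.adj e.2⟩ : E.Tot B A)
  /-- Multiplication is bilinear, associative and submultiplicative. -/
  add_mul : ∀ {A B C : E.Ind} {p : E.Base} (e e' : E.Fib A B p) (f : E.Fib B C p),
    E.mul (e + e') f = E.mul e f + E.mul e' f
  mul_add : ∀ {A B C : E.Ind} {p : E.Base} (e : E.Fib A B p) (f f' : E.Fib B C p),
    E.mul e (f + f') = E.mul e f + E.mul e f'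
  smul_mul : ∀ {A B C : E.Ind} {p : E.Base} (c : ℂ) (e : E.Fib A B p) (f : E.Fib B C p),
    E.mul (c • e) f = c • E.mul e f
  mul_smul : ∀ {A B C : E.Ind} {p : E.Base} (c : ℂ) (e : E.Fib A B p) (f : E.Fib B C p),
    E.mul e (c • f) = c • E.mul e f
  mul_assoc : ∀ {A B C D : E.Ind} {p : E.Base}
    (e : E.Fib A B p) (f : E.Fib B C p) (g : E.Fib C D p),
    E.mul (E.mul e f) g = E.mul e (E.mul f g)
  norm_mul_le : ∀ {A B C : E.Ind} {p : E.Base} (e : E.Fib A B p) (f : E.Fib B C p),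
    ‖E.mul e f‖ ≤ ‖e‖ * ‖f‖
  /-- The involution is conjugate linear, involutive and antimultiplicative. -/
  adj_add : ∀ {A B : E.Ind} {p : E.Base} (e f : E.Fib A B p),
    E.adj (e + f) = E.adj e + E.adj f
  adj_smul : ∀ {A B : E.Ind} {p : E.Base} (c : ℂ) (e : E.Fib A B p),
    E.adj (c • e) = conj c • E.adj e
  adj_adj : ∀ {A B : E.Ind} {p : E.Base} (e : E.Fib A B p), E.adj (E.adj e) = e
  adj_mul : ∀ {A B C : E.Ind} {p : E.Base} (e : E.Fib A B p) (f : E.Fib B C p),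
    E.adj (E.mul e f) = E.mul (E.adj f) (E.adj e)
  /-- The C*-property, and positivity of `e* e` in its fibre. -/
  norm_adj_mul : ∀ {A B : E.Ind} {p : E.Base} (e : E.Fib A B p),
    ‖E.mul (E.adj e) e‖ = ‖e‖ ^ 2
  positive : ∀ {A B : E.Ind} {p : E.Base} (e : E.Fib A B p),
    ∃ f : E.Fib B B p, E.mul (E.adj e) e = E.mul (E.adj f) f
  /-- The bundle is unital. -/
  one_mul : ∀ {A B : E.Ind} {p : E.Base} (e : E.Fib A B p), E.mul (E.one A p) e = e
  mul_one : ∀ {A B : E.Ind} {p : E.Base} (e : E.Fib A B p), E.mul e (E.one B p) = e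
  /-- The bundle is saturated: each fibre is a full Hilbert C*-bimodule. -/
  saturated : ∀ (A B : E.Ind) (p : E.Base),
    Dense (Submodule.span ℂ {z | ∃ e f : E.Fib A B p, z = E.mul (E.adj e) f} :
      Set (E.Fib B B p)) ∧
    Dense (Submodule.span ℂ {z | ∃ e f : E.Fib A B p, z = E.mul e (E.adj f)} :
      Set (E.Fib A A p))

/-- Topological spaceoids. -/
structure Spaceoid extends SpaceoidData.{u} where
  property : IsSpaceoid toSpaceoidData

/-- The data of a morphism of spaceoids `(f, 𝓕) : E₁ → E₂`: the map `f_Δ : X₁ → X₂` (`base`), the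
isomorphism `f_R : R_{O₁} → R_{O₂}` of total equivalence relations, given by a bijection
`O₁ ≃ O₂` (`ind`), and a fibrewise linear map `𝓕 : f^•(E₂) → E₁`.  The fibre of the pull-back
`f^•(E₂)` over the point `p_{f_R⁻¹(A) f_R⁻¹(B)}` of `Δ_{X₁} × R_{O₁}` is the fibre of `E₂` over
`f_Δ(p)_{AB}`; the fibres of `f^•(E₂)` are indexed here by `p ∈ X₁` and `A, B ∈ O₂`. -/
structure SpaceoidHomData (E₁ E₂ : SpaceoidData.{u}) where
  base : E₁.Base → E₂.Base
  ind : E₁.Ind ≃ E₂.Ind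
  fib : ∀ (A B : E₂.Ind) (p : E₁.Base),
    E₂.Fib A B (base p) →ₗ[ℂ] E₁.Fib (ind.symm A) (ind.symm B) p

/-- The axioms of a morphism of spaceoids: `f_Δ` is continuous, and `𝓕` is a continuous
*-functor. -/
structure IsSpaceoidHom {E₁ E₂ : SpaceoidData.{u}} (f : SpaceoidHomData E₁ E₂) : Prop where
  continuous_base : Continuous f.base
  continuous_fib : ∀ A B : E₂.Ind,
    Continuous fun z : TotalSpace ℂ (f.base *ᵖ (E₂.Fib A B)) =>
      (⟨z.1, f.fib A B z.1 z.2⟩ : E₁.Tot (f.ind.symm A) (f.ind.symm B))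
  fib_mul : ∀ (A B C : E₂.Ind) (p : E₁.Base)
    (e : E₂.Fib A B (f.base p)) (e' : E₂.Fib B C (f.base p)),
    f.fib A C p (E₂.mul e e') = E₁.mul (f.fib A B p e) (f.fib B C p e')
  fib_adj : ∀ (A B : E₂.Ind) (p : E₁.Base) (e : E₂.Fib A B (f.base p)),
    f.fib B A p (E₂.adj e) = E₁.adj (f.fib A B p e)
  fib_one : ∀ (A : E₂.Ind) (p : E₁.Base),
    f.fib A A p (E₂.one A (f.base p)) = E₁.one (f.ind.symm A) p

/-- The identity morphism. -/
def SpaceoidHomData.id (E : SpaceoidData.{u}) : SpaceoidHomData E E where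
  base := fun p => p
  ind := Equiv.refl _
  fib := fun _ _ _ => LinearMap.id

/-- The composition `(g, 𝓖) ∘ (f, 𝓕) = (g ∘ f, 𝓕 ∘ f^•(𝓖))`. -/
def SpaceoidHomData.comp {E₁ E₂ E₃ : SpaceoidData.{u}} (f : SpaceoidHomData E₁ E₂)
    (g : SpaceoidHomData E₂ E₃) : SpaceoidHomData E₁ E₃ where
  base := fun p => g.base (f.base p)
  ind := f.ind.trans g.ind
  fib := fun A B p => (f.fib (g.ind.symm A) (g.ind.symm B) p).comp (g.fib A B (f.base p))

/-- Morphisms of spaceoids. -/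
@[ext]
structure SpaceoidHom (E₁ E₂ : SpaceoidData.{u}) where
  data : SpaceoidHomData E₁ E₂
  property : IsSpaceoidHom data

theorem IsSpaceoidHom.id (E : SpaceoidData.{u}) : IsSpaceoidHom (SpaceoidHomData.id E) where
  continuous_base := continuous_id
  continuous_fib A B := Pullback.continuous_lift ℂ (E.Fib A B) _
  fib_mul _ _ _ _ _ _ := rfl
  fib_adj _ _ _ _ := rfl
  fib_one _ _ := rfl

theorem IsSpaceoidHom.comp {E₁ E₂ E₃ : SpaceoidData.{u}} {f : SpaceoidHomData E₁ E₂}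
    {g : SpaceoidHomData E₂ E₃} (hf : IsSpaceoidHom f) (hg : IsSpaceoidHom g) :
    IsSpaceoidHom (f.comp g) where
  continuous_base := hg.continuous_base.comp hf.continuous_base
  continuous_fib A B := by
    let s : TotalSpace ℂ ((f.comp g).base *ᵖ (E₃.Fib A B)) →
        TotalSpace ℂ (g.base *ᵖ (E₃.Fib A B)) := fun z => ⟨f.base z.1, z.2⟩
    have hs : Continuous s := by
      rw [(inducing_pullbackTotalSpaceEmbedding ℂ (E₃.Fib A B) g.base).continuous_iff]
      exact Continuous.prodMk
        (hf.continuous_base.comp (Pullback.continuous_proj ℂ (E₃.Fib A B) _))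
        (Pullback.continuous_lift ℂ (E₃.Fib A B) _)
    let t : TotalSpace ℂ ((f.comp g).base *ᵖ (E₃.Fib A B)) →
        TotalSpace ℂ (f.base *ᵖ (E₂.Fib (g.ind.symm A) (g.ind.symm B))) :=
      fun z => ⟨z.1, g.fib A B (f.base z.1) z.2⟩
    have ht : Continuous t := by
      rw [(inducing_pullbackTotalSpaceEmbedding ℂ
        (E₂.Fib (g.ind.symm A) (g.ind.symm B)) f.base).continuous_iff]
      exact Continuous.prodMk (Pullback.continuous_proj ℂ (E₃.Fib A B) _)
        ((hg.continuous_fib A B).comp hs)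
    exact (hf.continuous_fib _ _).comp ht
  fib_mul A B C p e e' := by
    exact (congrArg (f.fib _ _ p) (hg.fib_mul A B C (f.base p) e e')).trans
      (hf.fib_mul _ _ _ p _ _)
  fib_adj A B p e := by
    exact (congrArg (f.fib _ _ p) (hg.fib_adj A B (f.base p) e)).trans (hf.fib_adj _ _ p _)
  fib_one A p := by
    exact (congrArg (f.fib _ _ p) (hg.fib_one A (f.base p))).trans (hf.fib_one _ p)

/-- The category of spaceoids. -/
instance : Category Spaceoid.{u} where
  Hom E₁ E₂ := SpaceoidHom E₁.toSpaceoidData E₂.toSpaceoidData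
  id E := ⟨SpaceoidHomData.id _, IsSpaceoidHom.id _⟩
  comp f g := ⟨f.data.comp g.data, f.property.comp g.property⟩

/-! ## The section functor `Γ` -/

section Sections

variable {E : SpaceoidData.{u}}

/-- A continuous section over `Δ_X × {(A, B)}`. -/
def IsContSection {A B : E.Ind} (σ : ∀ p, E.Fib A B p) : Prop :=
  Continuous fun p => (⟨p, σ p⟩ : E.Tot A B)

theorem contSection_iff {A B : E.Ind} (σ : ∀ p, E.Fib A B p) {p : E.Base}
    (e : Trivialization ℂ (TotalSpace.proj : E.Tot A B → E.Base)) (hp : p ∈ e.baseSet) :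
    ContinuousAt (fun p => (⟨p, σ p⟩ : E.Tot A B)) p ↔
      ContinuousAt (fun p => (e ⟨p, σ p⟩).2) p := by
  have hn : (fun p => (⟨p, σ p⟩ : E.Tot A B)) ⁻¹' e.source ∈ nhds p := by
    refine Filter.mem_of_superset (e.open_baseSet.mem_nhds hp) fun q hq => ?_
    simpa [e.mem_source] using hq
  rw [e.toOpenPartialHomeomorph.continuousAt_iff_continuousAt_comp_left hn]
  have h1 : ContinuousAt (fun q => ((fun p => e (⟨p, σ p⟩ : E.Tot A B)) q).1) p := by
    refine continuousAt_id.congr ?_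
    filter_upwards [e.open_baseSet.mem_nhds hp] with q hq
    exact (e.coe_fst (x := (⟨q, σ q⟩ : E.Tot A B)) (e.mem_source.2 hq)).symm
  constructor
  · intro h
    exact continuous_snd.continuousAt.comp h
  · intro h
    exact h1.prodMk h

theorem contSection_of_local {A B : E.Ind} (hE : IsSpaceoid E) (σ : ∀ p, E.Fib A B p)
    (h : ∀ (p : E.Base) (e : Trivialization ℂ (TotalSpace.proj : E.Tot A B → E.Base)),
      p ∈ e.baseSet → e.IsLinear ℂ → ContinuousAt (fun p => (e ⟨p, σ p⟩).2) p) :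
    IsContSection σ := by
  rw [IsContSection, continuous_iff_continuousAt]
  intro p
  obtain ⟨e, hp, he⟩ := hE.locally_trivial A B p
  exact (contSection_iff σ e hp).2 (h p e hp he)

theorem IsContSection.loc {A B : E.Ind} {σ : ∀ p, E.Fib A B p} (h : IsContSection σ)
    {p : E.Base} (e : Trivialization ℂ (TotalSpace.proj : E.Tot A B → E.Base))
    (hp : p ∈ e.baseSet) : ContinuousAt (fun p => (e ⟨p, σ p⟩).2) p :=
  (contSection_iff σ e hp).1 (continuous_iff_continuousAt.1 h p)

theorem IsContSection.zero {A B : E.Ind} (hE : IsSpaceoid E) :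
    IsContSection (E := E) (A := A) (B := B) fun _ => 0 := by
  refine contSection_of_local hE _ fun p e hp he => ?_
  refine (continuousAt_const (y := (0 : ℂ))).congr ?_
  filter_upwards [e.open_baseSet.mem_nhds hp] with q hq
  exact (e.linear ℂ hq).map_zero.symm

theorem IsContSection.add {A B : E.Ind} (hE : IsSpaceoid E) {σ τ : ∀ p, E.Fib A B p}
    (hσ : IsContSection σ) (hτ : IsContSection τ) : IsContSection fun p => σ p + τ p := by
  refine contSection_of_local hE _ fun p e hp he => ?_
  refine ((hσ.loc e hp).add (hτ.loc e hp)).congr ?_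
  filter_upwards [e.open_baseSet.mem_nhds hp] with q hq
  exact ((e.linear ℂ hq).map_add _ _).symm

theorem IsContSection.smul {A B : E.Ind} (hE : IsSpaceoid E) (c : ℂ) {σ : ∀ p, E.Fib A B p}
    (hσ : IsContSection σ) : IsContSection fun p => c • σ p := by
  refine contSection_of_local hE _ fun p e hp he => ?_
  refine ((hσ.loc e hp).const_smul c).congr ?_
  filter_upwards [e.open_baseSet.mem_nhds hp] with q hq
  exact ((e.linear ℂ hq).map_smul _ _).symm

theorem contAt_mul {A B C : E.Ind} (hE : IsSpaceoid E)
    {σ : ∀ p, E.Fib A B p} {τ : ∀ p, E.Fib B C p} {p : E.Base}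
    (hσ : ContinuousAt (fun p => (⟨p, σ p⟩ : E.Tot A B)) p)
    (hτ : ContinuousAt (fun p => (⟨p, τ p⟩ : E.Tot B C)) p) :
    ContinuousAt (fun p => (⟨p, E.mul (σ p) (τ p)⟩ : E.Tot A C)) p := by
  have h : ContinuousAt (fun p => (⟨p, (σ p, τ p)⟩ :
      TotalSpace (ℂ × ℂ) (E.Fib A B ×ᵇ E.Fib B C))) p := by
    rw [(FiberBundle.Prod.isInducing_diag ℂ (E.Fib A B) ℂ (E.Fib B C)).continuousAt_iff]
    exact hσ.prodMk hτ
  exact (hE.continuous_mul A B C).continuousAt.comp h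

theorem IsContSection.mul {A B C : E.Ind} (hE : IsSpaceoid E)
    {σ : ∀ p, E.Fib A B p} {τ : ∀ p, E.Fib B C p}
    (hσ : IsContSection σ) (hτ : IsContSection τ) :
    IsContSection fun p => E.mul (σ p) (τ p) := by
  rw [IsContSection, continuous_iff_continuousAt] at *
  exact fun p => contAt_mul hE (hσ p) (hτ p)

theorem IsContSection.adj {A B : E.Ind} (hE : IsSpaceoid E)
    {σ : ∀ p, E.Fib A B p} (hσ : IsContSection σ) :
    IsContSection fun p => E.adj (σ p) :=
  (hE.continuous_adj A B).comp hσ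

theorem IsContSection.one {A : E.Ind} (hE : IsSpaceoid E) :
    IsContSection fun p => E.one A p := by
  refine contSection_of_local hE _ fun p e hp he => ?_
  -- near `p` let `s` be the section with constant coordinate `1`
  let s : ∀ q, E.Fib A A q := fun q => e.symm q 1
  have hs1 : ∀ q ∈ e.baseSet, (e ⟨q, s q⟩).2 = 1 := fun q hq => by
    rw [e.apply_mk_symm hq]
  have hs : ContinuousAt (fun p => (⟨p, s p⟩ : E.Tot A A)) p := by
    rw [contSection_iff s e hp]
    refine (continuousAt_const (y := (1 : ℂ))).congr ?_
    filter_upwards [e.open_baseSet.mem_nhds hp] with q hq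
    exact (hs1 q hq).symm
  have hss := (contSection_iff (fun q => E.mul (s q) (s q)) e hp).1 (contAt_mul hE hs hs)
  have key : ∀ q ∈ e.baseSet,
      (e ⟨q, E.one A q⟩).2 * (e ⟨q, E.mul (s q) (s q)⟩).2 = 1 := by
    intro q hq
    have h1 : E.one A q = (e ⟨q, E.one A q⟩).2 • s q := by
      apply (e.linearEquivAt ℂ q hq).injective
      rw [map_smul]
      simp [hs1 q hq]
    have h2 : s q = (e ⟨q, E.one A q⟩).2 • E.mul (s q) (s q) := by
      rw [← hE.smul_mul, ← h1, hE.one_mul]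
    have h3 := hs1 q hq
    have h4 : (e.linearEquivAt ℂ q hq) (s q) = 1 := h3
    rw [h2, map_smul] at h4
    simpa using h4
  have hne : (e ⟨p, E.mul (s p) (s p)⟩).2 ≠ 0 := right_ne_zero_of_mul_eq_one (key p hp)
  refine (hss.inv₀ hne).congr ?_
  filter_upwards [e.open_baseSet.mem_nhds hp] with q hq
  exact (eq_inv_of_mul_eq_one_left (key q hq)).symm

end Sections

/-- The set `Γ(Δ_X × {(A, B)}; E)` of continuous sections. -/
def Sec (E : Spaceoid.{u}) (A B : E.Ind) : Type u :=
  {σ : ∀ p, E.Fib A B p // IsContSection (E := E.toSpaceoidData) σ}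

namespace Sec

variable {E : Spaceoid.{u}} {A B C : E.Ind}

@[ext]
theorem ext {σ τ : Sec E A B} (h : ∀ p, σ.1 p = τ.1 p) : σ = τ :=
  Subtype.ext (funext h)

/-- The continuous sections, as a subspace of all sections. -/
def submodule (E : Spaceoid.{u}) (A B : E.Ind) : Submodule ℂ (∀ p, E.Fib A B p) where
  carrier := {σ | IsContSection (E := E.toSpaceoidData) σ}
  zero_mem' := IsContSection.zero E.property
  add_mem' := IsContSection.add E.property
  smul_mem' := fun c _ h => IsContSection.smul E.property c h

instance : AddCommGroup (Sec E A B) := inferInstanceAs (AddCommGroup (submodule E A B))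

instance : Module ℂ (Sec E A B) := inferInstanceAs (Module ℂ (submodule E A B))

/-- `‖σ‖ = sup_p ‖σ_p‖`. -/
instance : Norm (Sec E A B) := ⟨fun σ => ⨆ p, ‖σ.1 p‖⟩

theorem norm_def (σ : Sec E A B) : ‖σ‖ = ⨆ p, ‖σ.1 p‖ := rfl

theorem bddAbove (σ : Sec E A B) : BddAbove (Set.range fun p => ‖σ.1 p‖) := by
  have := E.property.compact
  exact (isCompact_range ((E.property.continuous_norm A B).comp σ.2)).bddAbove

theorem norm_apply_le (σ : Sec E A B) (p : E.Base) : ‖σ.1 p‖ ≤ ‖σ‖ := le_ciSup (bddAbove σ) p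

theorem norm_nonneg' (σ : Sec E A B) : 0 ≤ ‖σ‖ := Real.iSup_nonneg fun _ => norm_nonneg _

theorem norm_core : NormedSpace.Core ℂ (Sec E A B) where
  norm_nonneg := norm_nonneg'
  norm_smul c σ := by
    rw [norm_def, norm_def, Real.mul_iSup_of_nonneg (norm_nonneg c)]
    exact iSup_congr fun p => norm_smul c (σ.1 p)
  norm_triangle σ τ := by
    refine Real.iSup_le (fun p => ?_) (add_nonneg (norm_nonneg' σ) (norm_nonneg' τ))
    exact (norm_add_le (σ.1 p) (τ.1 p)).trans (add_le_add (norm_apply_le σ p) (norm_apply_le τ p))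
  norm_eq_zero_iff σ := by
    constructor
    · intro h
      ext p
      have := norm_apply_le σ p
      rw [h] at this
      exact norm_le_zero_iff.1 this
    · rintro rfl
      rw [norm_def]
      have : ∀ p, ‖(0 : Sec E A B).1 p‖ = 0 := fun p => norm_zero
      simp [this]

instance normedAddCommGroup : NormedAddCommGroup (Sec E A B) := NormedAddCommGroup.ofCore norm_core

instance normedSpace : NormedSpace ℂ (Sec E A B) := NormedSpace.ofCore norm_core

end Sec

/-- The set of objects of `Γ(E)`, which is the set `O`. -/
def SecObj (E : Spaceoid.{u}) : Type u := E.Ind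

/-- The category `Γ(E)`: the arrows `B ⟶ A` are the continuous sections over `Δ_X × {(A, B)}`,
with pointwise composition. -/
instance (E : Spaceoid.{u}) : SmallCategory (SecObj E) where
  Hom B A := Sec E A B
  id A := ⟨fun p => E.one A p, IsContSection.one E.property⟩
  comp σ ρ := ⟨fun p => E.mul (ρ.1 p) (σ.1 p), ρ.2.mul E.property σ.2⟩
  id_comp _ := Sec.ext fun _ => E.property.mul_one _
  comp_id _ := Sec.ext fun _ => E.property.one_mul _
  assoc _ _ _ := Sec.ext fun _ => (E.property.mul_assoc _ _ _).symm

/-- `Γ(E)`, with the pointwise operations and the supremum norm. -/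
def secData (E : Spaceoid.{u}) : StarCatData.{u} where
  Obj := SecObj E
  normedGroup := fun B A => Sec.normedAddCommGroup (E := E) (A := A) (B := B)
  normedSpace := fun B A => Sec.normedSpace (E := E) (A := A) (B := B)
  adj := fun {B A} (σ : Sec E A B) =>
    (⟨fun p => E.adj (σ.1 p), σ.2.adj E.property⟩ : Sec E B A)

/-- The section `𝓕 ∘ f^•(σ)` of `E₁`, for a section `σ` of `E₂`. -/
def secMap {E₁ E₂ : Spaceoid.{u}} (f : E₁ ⟶ E₂) {A B : E₂.Ind} (σ : Sec E₂ A B) :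
    Sec E₁ (f.data.ind.symm A) (f.data.ind.symm B) :=
  ⟨fun p => f.data.fib A B p (σ.1 (f.data.base p)), by
    have h : Continuous fun p : E₁.Base =>
        (⟨p, σ.1 (f.data.base p)⟩ : TotalSpace ℂ (f.data.base *ᵖ (E₂.Fib A B))) := by
      rw [(inducing_pullbackTotalSpaceEmbedding ℂ (E₂.Fib A B) f.data.base).continuous_iff]
      exact continuous_id.prodMk (σ.2.comp f.property.continuous_base)
    exact (f.property.continuous_fib A B).comp h⟩

/-- `Γ_{(f, 𝓕)} : Γ(E₂) → Γ(E₁)`, `σ ↦ 𝓕 ∘ f^•(σ)`, which is `f_R⁻¹` on the objects. -/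
def secFunctor {E₁ E₂ : Spaceoid.{u}} (f : E₁ ⟶ E₂) : (secData E₂).Obj ⥤ (secData E₁).Obj where
  obj A := f.data.ind.symm A
  map σ := secMap f σ
  map_id A := Sec.ext fun p => f.property.fib_one A p
  map_comp _ _ := Sec.ext fun p => f.property.fib_mul _ _ _ p _ _

/-- `Γ` is a contravariant functor from spaceoids to commutative full C*-categories. -/
structure GammaIsFunctor : Prop where
  obj : ∀ E : Spaceoid.{u}, IsFullCommCStarCat (secData E)
  map : ∀ {E₁ E₂ : Spaceoid.{u}} (f : E₁ ⟶ E₂), IsObjBijStarFunctor (secFunctor f)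
  map_id : ∀ E : Spaceoid.{u}, secFunctor (𝟙 E) = 𝟭 (secData E).Obj
  map_comp : ∀ {E₁ E₂ E₃ : Spaceoid.{u}} (f : E₁ ⟶ E₂) (g : E₂ ⟶ E₃),
    secFunctor (f ≫ g) = secFunctor g ⋙ secFunctor f

/-- The functor `Γ`. -/
def GammaFunctor (h : GammaIsFunctor.{u}) : Spaceoid.{u}ᵒᵖ ⥤ FullCommCStarCat.{u} where
  obj E := ⟨secData E.unop, h.obj E.unop⟩
  map f := ⟨secFunctor f.unop, h.map f.unop⟩
  map_id E := ObjBijStarFunctor.ext (h.map_id E.unop)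
  map_comp f g := ObjBijStarFunctor.ext (h.map_comp g.unop f.unop)

/-! ## The spectral functor `Σ` -/

/-- `ℂ`-valued *-functors `ω : C → ℂ`, where `ℂ` is a C*-category with one object. -/
structure CFunctor (C : StarCatData.{u}) where
  toFun : ∀ {A B : C.Obj}, (A ⟶ B) →ₗ[ℂ] ℂ
  map_id : ∀ A : C.Obj, toFun (𝟙 A) = 1
  map_comp : ∀ {A B D : C.Obj} (x : A ⟶ B) (y : B ⟶ D), toFun (x ≫ y) = toFun y * toFun x
  map_adj : ∀ {A B : C.Obj} (x : A ⟶ B), toFun (C.adj x) = conj (toFun x)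

/-- `[C; ℂ]` has the weakest topology making all evaluations continuous. -/
instance (C : StarCatData.{u}) : TopologicalSpace (CFunctor C) :=
  ⨅ (A : C.Obj) (B : C.Obj) (x : A ⟶ B),
    TopologicalSpace.induced (fun ω : CFunctor C => ω.toFun x) inferInstance

/-- The restriction `ω ∘ Φ` of a `ℂ`-valued *-functor along a *-functor. -/
def CFunctor.comp {C D : StarCatData.{u}} (ω : CFunctor D) (Φ : ObjBijStarFunctor C D) :
    CFunctor C where
  toFun :=
    { toFun := fun x => ω.toFun (Φ.functor.map x)
      map_add' := fun x y => by rw [Φ.property.map_add, map_add]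
      map_smul' := fun c x => by rw [Φ.property.map_smul, map_smul]; rfl }
  map_id A := by simp [ω.map_id]
  map_comp x y := by simp [ω.map_comp]
  map_adj x := by simp [Φ.property.map_adj, ω.map_adj]

/-- Unitary equivalence of `ℂ`-valued *-functors: there is a natural transformation between them
whose components are complex numbers of modulus one. -/
def unitarySetoid (C : StarCatData.{u}) : Setoid (CFunctor C) where
  r ω₁ ω₂ := ∃ ν : C.Obj → Circle, ∀ (A B : C.Obj) (x : B ⟶ A),
    (ν A : ℂ) * ω₁.toFun x = ω₂.toFun x * (ν B : ℂ)
  iseqv :=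
    { refl := fun ω => ⟨fun _ => 1, fun A B x => by simp⟩
      symm := by
        rintro ω₁ ω₂ ⟨ν, h⟩
        refine ⟨fun A => (ν A)⁻¹, fun A B x => ?_⟩
        have h1 := h A B x
        have hA : (ν A : ℂ) ≠ 0 := Circle.coe_ne_zero _
        have hB : (ν B : ℂ) ≠ 0 := Circle.coe_ne_zero _
        push_cast
        field_simp
        linear_combination -h1
      trans := by
        rintro ω₁ ω₂ ω₃ ⟨ν, h⟩ ⟨μ, k⟩
        refine ⟨fun A => μ A * ν A, fun A B x => ?_⟩
        push_cast
        linear_combination (μ A : ℂ) * h A B x + (ν B : ℂ) * k A B x }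

/-- The base spectrum `Sp_b(C)`, with the quotient topology. -/
abbrev BaseSpectrum (C : StarCatData.{u}) : Type u := Quotient (unitarySetoid C)

/-- `I_{[ω]_{AB}} = {x ∈ C_{AB} | ω(x) = 0}`. -/
def idealAt {C : StarCatData.{u}} (q : BaseSpectrum C) (A B : C.Obj) : Submodule ℂ (B ⟶ A) :=
  Quotient.liftOn q (fun ω => LinearMap.ker (ω.toFun : (B ⟶ A) →ₗ[ℂ] ℂ)) (by
    rintro ω₁ ω₂ ⟨ν, h⟩
    ext x
    have h1 := h A B x
    simp only [LinearMap.mem_ker]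
    constructor
    · intro h0
      rw [h0, mul_zero] at h1
      exact (mul_eq_zero.1 h1.symm).resolve_right (Circle.coe_ne_zero _)
    · intro h0
      rw [h0, zero_mul] at h1
      exact (mul_eq_zero.1 h1).resolve_left (Circle.coe_ne_zero _))

theorem mem_idealAt {C : StarCatData.{u}} (ω : CFunctor C) {A B : C.Obj} (x : B ⟶ A) :
    x ∈ idealAt (Quotient.mk _ ω) A B ↔ ω.toFun x = 0 := Iff.rfl

theorem comp_mem_idealAt {C : StarCatData.{u}} (q : BaseSpectrum C) {A B D : C.Obj}
    (x : B ⟶ A) (y : D ⟶ B) (h : x ∈ idealAt q A B ∨ y ∈ idealAt q B D) :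
    y ≫ x ∈ idealAt q A D := by
  induction q using Quotient.inductionOn with
  | h ω =>
    rw [mem_idealAt, mem_idealAt] at h
    rw [mem_idealAt, ω.map_comp]
    exact mul_eq_zero.2 h

theorem adj_mem_idealAt {C : StarCatData.{u}} (q : BaseSpectrum C) {A B : C.Obj}
    (x : B ⟶ A) (h : x ∈ idealAt q A B) : C.adj x ∈ idealAt q B A := by
  induction q using Quotient.inductionOn with
  | h ω =>
    rw [mem_idealAt] at h
    rw [mem_idealAt, ω.map_adj, h, map_zero]

theorem CFunctor.bound {C : StarCatData.{u}} (hC : IsCStarCat C) (ω : CFunctor C) {A B : C.Obj}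
    (x : A ⟶ B) : ‖ω.toFun x‖ ≤ Real.sqrt ‖𝟙 A‖ * ‖x‖ := by
  have := hC.complete A A
  let _ : NormedRing (A ⟶ A) :=
    { C.normedGroup A A with
      mul := fun f g => g ≫ f
      one := 𝟙 A
      mul_assoc := fun f g h => (Category.assoc h g f).symm
      one_mul := fun f => Category.comp_id f
      mul_one := fun f => Category.id_comp f
      left_distrib := fun f g h => hC.add_comp g h f
      right_distrib := fun f g h => hC.comp_add h f g
      zero_mul := fun f => by
        change f ≫ (0 : A ⟶ A) = 0
        simpa using hC.comp_smul 0 f (0 : A ⟶ A)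
      mul_zero := fun f => by
        change (0 : A ⟶ A) ≫ f = 0
        simpa using hC.smul_comp 0 (0 : A ⟶ A) f
      norm_mul_le := fun f g => (hC.norm_comp_le g f).trans (mul_comm _ _).le }
  let _ : NormedAlgebra ℂ (A ⟶ A) :=
    { Algebra.ofModule (R := ℂ) (A := (A ⟶ A)) (fun c f g => hC.comp_smul c g f)
        (fun c f g => hC.smul_comp c g f) with
      norm_smul_le := fun c f => (norm_smul c f).le }
  let φ : (A ⟶ A) →ₐ[ℂ] ℂ := AlgHom.ofLinearMap (ω.toFun : (A ⟶ A) →ₗ[ℂ] ℂ) (ω.map_id A)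
    (fun f g => ω.map_comp g f)
  have h1 : ‖ω.toFun (x ≫ C.adj x)‖ ≤ ‖x ≫ C.adj x‖ * ‖𝟙 A‖ :=
    AlgHom.norm_apply_le_self_mul_norm_one φ (x ≫ C.adj x)
  rw [ω.map_comp, ω.map_adj, norm_mul, RCLike.norm_conj, hC.norm_comp_adj] at h1
  refine le_of_sq_le_sq ?_ (by positivity)
  rw [mul_pow, Real.sq_sqrt (norm_nonneg _)]
  linarith [sq ‖ω.toFun x‖]

theorem isClosed_idealAt {C : StarCatData.{u}} (hC : IsCStarCat C) (q : BaseSpectrum C)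
    (A B : C.Obj) : IsClosed (idealAt q A B : Set (B ⟶ A)) := by
  induction q using Quotient.inductionOn with
  | h ω =>
    have h : Continuous (ω.toFun : (B ⟶ A) →ₗ[ℂ] ℂ) :=
      AddMonoidHomClass.continuous_of_bound _ _ fun x => ω.bound hC x
    exact isClosed_singleton.preimage h

/-- The fibre `C_{AB} / I_{[ω]_{AB}}`. -/
def SpecFib (C : FullCommCStarCat.{u}) (A B : C.Obj) (q : BaseSpectrum C.toStarCatData) : Type u :=
  (B ⟶ A) ⧸ idealAt q A B

namespace SpecFib

variable {C : FullCommCStarCat.{u}} {A B D : C.Obj} {q : BaseSpectrum C.toStarCatData}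

/-- The quotient norm. -/
instance : NormedAddCommGroup (SpecFib C A B q) :=
  haveI := isClosed_idealAt C.property.isCStarCat q A B
  inferInstanceAs (NormedAddCommGroup ((B ⟶ A) ⧸ idealAt q A B))

instance : NormedSpace ℂ (SpecFib C A B q) :=
  inferInstanceAs (NormedSpace ℂ ((B ⟶ A) ⧸ idealAt q A B))

/-- The class `x + I_{[ω]_{AB}}`. -/
def mk (q : BaseSpectrum C.toStarCatData) (x : B ⟶ A) : SpecFib C A B q :=
  Submodule.Quotient.mk x

/-- `(x + I) (y + I) = x ∘ y + I`. -/
def mul : SpecFib C A B q → SpecFib C B D q → SpecFib C A D q :=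
  Quotient.map₂ (fun (x : B ⟶ A) (y : D ⟶ B) => y ≫ x) (by
    intro x x' hx y y' hy
    have hx' : x - x' ∈ idealAt q A B := (Submodule.quotientRel_def _).1 hx
    have hy' : y - y' ∈ idealAt q B D := (Submodule.quotientRel_def _).1 hy
    refine (Submodule.quotientRel_def _).2 ?_
    have h1 := C.property.isCStarCat.comp_add y (x - x') x'
    have h2 := C.property.isCStarCat.add_comp (y - y') y' x'
    rw [sub_add_cancel] at h1 h2
    have h3 : y ≫ x - y' ≫ x' = y ≫ (x - x') + (y - y') ≫ x' := by rw [h1, h2]; abel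
    rw [h3]
    exact add_mem (comp_mem_idealAt q _ _ (Or.inl hx')) (comp_mem_idealAt q _ _ (Or.inr hy')))

/-- `(x + I)* = x* + I`. -/
def adj : SpecFib C A B q → SpecFib C B A q :=
  Quotient.map (fun x : B ⟶ A => C.adj x) (by
    intro x x' hx
    have hx' : x - x' ∈ idealAt q A B := (Submodule.quotientRel_def _).1 hx
    refine (Submodule.quotientRel_def _).2 ?_
    have h1 := C.property.isCStarCat.adj_add (x - x') x'
    rw [sub_add_cancel] at h1
    rw [h1, add_sub_cancel_right]
    exact adj_mem_idealAt q _ hx')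

/-- The tube of radius `ε` around the section `x̂ : [ω] ↦ x + I_{[ω]_{AB}}` over the set `U`. -/
def tube (x : B ⟶ A) (U : Set (BaseSpectrum C.toStarCatData)) (ε : ℝ) :
    Set (TotalSpace ℂ (SpecFib C A B)) :=
  {e | e.1 ∈ U ∧ ‖e.2 - mk e.1 x‖ < ε}

/-- The topology of the total space, generated by the tubes around the sections `x̂`, for
`x ∈ C_{AB}`, over open subsets of the base spectrum. -/
instance (C : FullCommCStarCat.{u}) (A B : C.Obj) :
    TopologicalSpace (TotalSpace ℂ (SpecFib C A B)) :=
  TopologicalSpace.generateFrom {T | ∃ (x : B ⟶ A) (U : Set (BaseSpectrum C.toStarCatData)) (ε : ℝ),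
    IsOpen U ∧ T = tube x U ε}

end SpecFib

/-- The spectral spaceoid `Σ(C)`. -/
def specData (C : FullCommCStarCat.{u}) : SpaceoidData.{u} where
  Base := BaseSpectrum C.toStarCatData
  Ind := C.Obj
  Fib := SpecFib C
  mul := SpecFib.mul
  adj := SpecFib.adj
  one := fun A q => SpecFib.mk q (𝟙 A)

/-- The map `λ^Φ_Δ : [ω] ↦ [ω ∘ Φ]` of base spectra. -/
def baseMap {C D : FullCommCStarCat.{u}} (Φ : C ⟶ D) :
    BaseSpectrum D.toStarCatData → BaseSpectrum C.toStarCatData :=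
  Quotient.map (fun ω => ω.comp Φ) (by
    rintro ω₁ ω₂ ⟨ν, h⟩
    exact ⟨fun A => ν (Φ.functor.obj A), fun A B x => h _ _ _⟩)

/-- `Σ^Φ = (λ^Φ, Λ^Φ) : Σ(D) → Σ(C)`, where `λ^Φ_R = Φ_o⁻¹` and
`Λ^Φ : x + I_{λ^Φ([ω]_{AB})} ↦ Φ(x) + I_{[ω]_{AB}}`. -/
def specHomData {C D : FullCommCStarCat.{u}} (Φ : C ⟶ D) :
    SpaceoidHomData (specData D) (specData C) where
  base := baseMap Φ
  ind := (Equiv.ofBijective Φ.functor.obj Φ.property.bijective).symm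
  fib := fun (A B : C.Obj) q =>
    Submodule.mapQ (idealAt (baseMap Φ q) A B)
      (idealAt q (Φ.functor.obj A) (Φ.functor.obj B))
      { toFun := fun x => Φ.functor.map x
        map_add' := Φ.property.map_add
        map_smul' := Φ.property.map_smul }
      (by
        induction q using Quotient.inductionOn with
        | h ω => exact fun x hx => hx)

/-- `Σ` is a contravariant functor from commutative full C*-categories to spaceoids. -/
structure SigmaIsFunctor : Prop where
  obj : ∀ C : FullCommCStarCat.{u}, IsSpaceoid (specData C)
  map : ∀ {C D : FullCommCStarCat.{u}} (Φ : C ⟶ D), IsSpaceoidHom (specHomData Φ)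
  map_id : ∀ C : FullCommCStarCat.{u}, specHomData (𝟙 C) = SpaceoidHomData.id (specData C)
  map_comp : ∀ {C D K : FullCommCStarCat.{u}} (Φ : C ⟶ D) (Ψ : D ⟶ K),
    specHomData (Φ ≫ Ψ) = (specHomData Ψ).comp (specHomData Φ)

/-- The functor `Σ`. -/
def SigmaFunctor (h : SigmaIsFunctor.{u}) : FullCommCStarCat.{u}ᵒᵖ ⥤ Spaceoid.{u} where
  obj C := ⟨specData C.unop, h.obj C.unop⟩
  map Φ := ⟨specHomData Φ.unop, h.map Φ.unop⟩
  map_id C := SpaceoidHom.ext (h.map_id C.unop)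
  map_comp Φ Ψ := SpaceoidHom.ext (h.map_comp Ψ.unop Φ.unop)

/-! ## The Gel'fand and evaluation transforms -/

/-- The section `x̂ : [ω] ↦ x + I_{[ω]_{AB}}` of the spectral spaceoid. -/
def gelfandMap (C : FullCommCStarCat.{u}) (h : IsSpaceoid (specData C)) {A B : C.Obj}
    (x : B ⟶ A) : Sec ⟨specData C, h⟩ A B :=
  ⟨fun q => SpecFib.mk q x, by
    refine continuous_generateFrom_iff.2 ?_
    rintro _ ⟨y, U, ε, hU, rfl⟩
    have h0 := IsContSection.zero (E := specData C) (A := A) (B := B) h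
    have h1 : IsOpen (SpecFib.tube (y - x) U ε) :=
      TopologicalSpace.isOpen_generateFrom_of_mem ⟨y - x, U, ε, hU, rfl⟩
    convert h1.preimage h0 using 1
    refine Set.ext fun (q : BaseSpectrum C.toStarCatData) => ?_
    have h2 : (SpecFib.mk q x - SpecFib.mk q y : SpecFib C A B q) =
        0 - SpecFib.mk q (y - x) := by
      have h3 : (SpecFib.mk q (y - x) : SpecFib C A B q) = SpecFib.mk q y - SpecFib.mk q x := rfl
      rw [h3]
      abel
    change (q ∈ U ∧ ‖(SpecFib.mk q x - SpecFib.mk q y : SpecFib C A B q)‖ < ε) ↔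
      (q ∈ U ∧ ‖(0 - SpecFib.mk q (y - x) : SpecFib C A B q)‖ < ε)
    rw [h2]⟩

/-- The Gel'fand transform `C → Γ(Σ(C))`, `x ↦ x̂`. -/
def gelfandTransform (C : FullCommCStarCat.{u}) (h : IsSpaceoid (specData C)) :
    C.Obj ⥤ (secData ⟨specData C, h⟩).Obj where
  obj A := A
  map x := gelfandMap C h x

/-- `ℂ`-valued *-functors `γ` on the one-dimensional C*-category formed by the fibres of `E` over
the points `p_{AB}`, for a fixed `p`. -/
structure FibreFunctor (E : SpaceoidData.{u}) (p : E.Base) where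
  toFun : ∀ {A B : E.Ind}, E.Fib A B p →ₗ[ℂ] ℂ
  map_one : ∀ A : E.Ind, toFun (E.one A p) = 1
  map_mul : ∀ {A B C : E.Ind} (e : E.Fib A B p) (f : E.Fib B C p),
    toFun (E.mul e f) = toFun e * toFun f
  map_adj : ∀ {A B : E.Ind} (e : E.Fib A B p), toFun (E.adj e) = conj (toFun e)

/-- The linear form `γ ∘ ev_p` on `Γ(E)_{AB}`, where `ev_p(σ) = σ_p`. -/
def evalMap (E : Spaceoid.{u}) (p : E.Base) (γ : FibreFunctor E.toSpaceoidData p) (A B : E.Ind) :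
    Sec E A B →ₗ[ℂ] ℂ where
  toFun σ := γ.toFun (σ.1 p)
  map_add' σ τ := map_add γ.toFun (σ.1 p) (τ.1 p)
  map_smul' c σ := map_smul γ.toFun c (σ.1 p)

/-- The *-functor `γ ∘ ev_p : Γ(E) → ℂ`. -/
def evalFunctor (E : Spaceoid.{u}) (p : E.Base) (γ : FibreFunctor E.toSpaceoidData p) :
    CFunctor (secData E) where
  toFun {B A} := evalMap E p γ A B
  map_id A := γ.map_one A
  map_comp _ _ := γ.map_mul _ _
  map_adj _ := γ.map_adj _

/-- The morphism `(η, Ω) : E → Σ(Γ(E))` is the evaluation transform: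
`η_R (A, B) = (A, B)`; `η_Δ p = [γ ∘ ev_p]`, where a `ℂ`-valued *-functor `γ` on the fibres over `p`
exists and the class does not depend on its choice; and `Ω (p_{AB}, σ + I_{η(p_{AB})}) = σ_p`, as an
equality between elements of the disjoint union of the fibres over `p`. -/
structure IsEvaluationTransform (E : Spaceoid.{u}) (h : IsFullCommCStarCat (secData E))
    (m : SpaceoidHomData E.toSpaceoidData (specData ⟨secData E, h⟩)) : Prop where
  ind_apply : ∀ A : E.Ind, m.ind A = A
  exists_fibreFunctor : ∀ p : E.Base, Nonempty (FibreFunctor E.toSpaceoidData p)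
  base_apply : ∀ (p : E.Base) (γ : FibreFunctor E.toSpaceoidData p),
    m.base p = Quotient.mk (unitarySetoid (secData E)) (evalFunctor E p γ)
  fib_apply : ∀ (A B : E.Ind) (p : E.Base) (σ : Sec E A B),
    (⟨(m.ind.symm A, m.ind.symm B),
      m.fib A B p (SpecFib.mk (C := ⟨secData E, h⟩) (m.base p) σ)⟩ :
        Σ i : E.Ind × E.Ind, E.Fib i.1 i.2 p) = ⟨(A, B), σ.1 p⟩

end

end GelfandSpaceoid

open GelfandSpaceoid

/-! The duality combines commutative Gel'fand theory for the algebras C_{AA} with the fact that the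
full bimodules C_{AB} become one-dimensional at each point of the spectrum.

Fix an object O and a character χ of C_{OO}. Fullness prevents C_{AO} from vanishing at χ, so
positivity gives x_A ∈ C_{AO} with χ(x_A* x_A) = 1. Commutativity of the endomorphism algebras then
makes y ↦ χ(x_B* y x_A), for y ∈ C_{BA}, a *-functor extending χ (`exists_cfunctor_extending`).
Conversely, the restriction to C_{OO} determines a *-functor up to unitary equivalence
(`CFunctor.equiv_of_eq_on`). Hence Sp_b(C) is the Gel'fand spectrum of C_{OO}, for every O: it is
compact Hausdorff, and each continuous function on it comes from an element of C_{OO}.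

The analytic core is `SpecFib.norm_mk`: the quotient norm on C_{AB}/I_{[ω]} is |ω|. It makes the
fibres one-dimensional with a multiplicative norm, and makes [ω] ↦ ‖x + I_{[ω]}‖ continuous.
Convergence in Σ(C) can then be tested against the sections x̂ (`SpecFib.tendsto_tot_iff`), which
are local frames wherever they do not vanish.

Over a compact base, finitely many sections of a line bundle without common zeros generate all
sections over the continuous functions (`exists_eq_sum_smul`). This gives both the fullness of Γ(E)
and the surjectivity of the Gel'fand transform. The transform is isometric because the C*-identity
reduces the norm to characters, which extend to *-functors.

For a spaceoid E, taking coefficients with respect to the unit identifies Γ(E)_{OO} with C(X), whose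
characters are the points of X; so η_Δ is a homeomorphism. On fibres, σ + I ↦ σ_p is isometric, and
it is onto because every vector extends to a continuous section. Naturality and the triangle
identities are pointwise computations; on base points they use that [γ ∘ ev_p] does not depend on γ.
-/

namespace GelfandSpaceoid

noncomputable section

open Filter Topology WeakDual

/-! ## The fibres of a spaceoid -/

namespace IsSpaceoid

variable {E : SpaceoidData.{u}} (hE : IsSpaceoid E) {A B C : E.Ind} {p : E.Base}

include hE

theorem zero_mul (e : E.Fib B C p) : E.mul (0 : E.Fib A B p) e = 0 := by
  simpa using hE.smul_mul 0 (0 : E.Fib A B p) e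

theorem nontrivial (A B : E.Ind) (p : E.Base) : Nontrivial (E.Fib A B p) :=
  Module.nontrivial_of_finrank_pos (R := ℂ) (by rw [hE.rank_one A B p]; exact one_pos)

theorem one_ne_zero (A : E.Ind) (p : E.Base) : E.one A p ≠ 0 := by
  intro h
  have := hE.nontrivial A A p
  obtain ⟨e, he⟩ := exists_ne (0 : E.Fib A A p)
  exact he (by rw [← hE.one_mul e, h, hE.zero_mul])

theorem adj_one (A : E.Ind) (p : E.Base) : E.adj (E.one A p) = E.one A p := by
  have h := hE.adj_mul (E.adj (E.one A p)) (E.one A p)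
  rw [hE.mul_one, hE.adj_adj, hE.mul_one] at h
  exact h.symm

/-- The C*-identity and submultiplicativity give ‖e‖² ≤ ‖e*‖ ‖e‖. Cancelling gives one inequality,
and applying it to e* gives the other. -/
theorem norm_adj (e : E.Fib A B p) : ‖E.adj e‖ = ‖e‖ := by
  have key : ∀ {A B : E.Ind} (e : E.Fib A B p), ‖e‖ ≤ ‖E.adj e‖ := by
    intro A B e
    have h1 := (hE.norm_adj_mul e).symm.trans_le (hE.norm_mul_le (E.adj e) e)
    rcases eq_or_lt_of_le (norm_nonneg e) with h | h
    · rw [← h]; exact norm_nonneg _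
    · rw [sq] at h1
      exact le_of_mul_le_mul_right h1 h
  refine le_antisymm ?_ (key e)
  simpa [hE.adj_adj] using key (E.adj e)

theorem norm_one (A : E.Ind) (p : E.Base) : ‖E.one A p‖ = 1 := by
  have h := hE.norm_adj_mul (E.one A p)
  rw [hE.mul_one, hE.norm_adj, sq] at h
  exact (mul_eq_left₀ (norm_ne_zero_iff.2 (hE.one_ne_zero A p))).1 h.symm

theorem toSpanSingleton_bijective {e : E.Fib A B p} (he : e ≠ 0) :
    Function.Bijective (LinearMap.toSpanSingleton ℂ (E.Fib A B p) e) := by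
  constructor
  · intro c d h
    exact smul_left_injective ℂ he h
  · intro f
    exact (finrank_eq_one_iff_of_nonzero' e he).1 (hE.rank_one A B p) f

end IsSpaceoid

/-- The coefficient of an element of `E_{AA}` with respect to the unit. -/
def IsSpaceoid.coef {E : SpaceoidData.{u}} (hE : IsSpaceoid E) {A : E.Ind} {p : E.Base} :
    E.Fib A A p →ₗ[ℂ] ℂ :=
  (LinearEquiv.ofBijective _
    (hE.toSpanSingleton_bijective (hE.one_ne_zero A p))).symm.toLinearMap

namespace IsSpaceoid

variable {E : SpaceoidData.{u}} (hE : IsSpaceoid E) {A B C : E.Ind} {p : E.Base}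

theorem coef_smul_one (e : E.Fib A A p) : hE.coef e • E.one A p = e :=
  (LinearEquiv.ofBijective _
    (hE.toSpanSingleton_bijective (hE.one_ne_zero A p))).apply_symm_apply e

theorem coef_one : hE.coef (E.one A p) = 1 := by
  have h := hE.coef_smul_one (E.one A p)
  rw [← one_smul ℂ (E.one A p), smul_smul, _root_.mul_one] at h
  have := smul_left_injective ℂ (hE.one_ne_zero A p) h
  simpa using this

/-- Diagonal elements are multiples of the unit, so they act as scalars. This allows products in
different fibres to be compared without choosing bases. -/
theorem coef_smul_mul (e : E.Fib A A p) (f : E.Fib A B p) : hE.coef e • f = E.mul e f := by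
  conv_rhs => rw [← hE.coef_smul_one e, hE.smul_mul, hE.one_mul]

theorem coef_smul_mul' (e : E.Fib A B p) (f : E.Fib B B p) : hE.coef f • e = E.mul e f := by
  conv_rhs => rw [← hE.coef_smul_one f, hE.mul_smul, hE.mul_one]

theorem coef_mul (e f : E.Fib A A p) : hE.coef (E.mul e f) = hE.coef e * hE.coef f := by
  rw [← hE.coef_smul_mul, map_smul, smul_eq_mul]

theorem coef_adj (e : E.Fib A A p) : hE.coef (E.adj e) = conj (hE.coef e) := by
  conv_lhs => rw [← hE.coef_smul_one e, hE.adj_smul, hE.adj_one, map_smul, hE.coef_one]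
  simp

theorem norm_coef (e : E.Fib A A p) : ‖hE.coef e‖ = ‖e‖ := by
  conv_rhs => rw [← hE.coef_smul_one e, norm_smul, hE.norm_one, _root_.mul_one]

theorem coef_injective : Function.Injective (hE.coef (A := A) (p := p)) := fun e f h => by
  rw [← hE.coef_smul_one e, h, hE.coef_smul_one]

/-- The C*-identity fixes only the modulus of this scalar. Positivity fixes its phase: e*e = f*f
with f diagonal, and the coefficient of f*f is |coef f|². -/
theorem coef_adj_mul_self (e : E.Fib A B p) : hE.coef (E.mul (E.adj e) e) = ((‖e‖ ^ 2 : ℝ) : ℂ) := by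
  obtain ⟨f, hf⟩ := hE.positive e
  rw [← hE.norm_adj_mul e, hf, ← hE.norm_coef, hE.coef_mul, hE.coef_adj, norm_mul,
    RCLike.norm_conj, ← Complex.normSq_eq_conj_mul_self, Complex.normSq_eq_norm_sq]
  push_cast
  ring

theorem coef_mul_adj_self (e : E.Fib A B p) : hE.coef (E.mul e (E.adj e)) = ((‖e‖ ^ 2 : ℝ) : ℂ) := by
  have h := hE.coef_adj_mul_self (E.adj e)
  rwa [hE.adj_adj, hE.norm_adj] at h

include hE in
theorem mul_comm (e f : E.Fib A A p) : E.mul e f = E.mul f e :=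
  hE.coef_injective (by rw [hE.coef_mul, hE.coef_mul, _root_.mul_comm])


end IsSpaceoid

/-! ## Continuous sections of a spaceoid -/

section Sections

variable {E : SpaceoidData.{u}} {A B : E.Ind}

/-- In rank one a vector is its coordinate times the frame vector, so in each fibre the norm is the
modulus of the coordinate up to the norm of the frame. -/
theorem norm_eq_norm_coord_mul {p : E.Base}
    (e : Trivialization ℂ (TotalSpace.proj : E.Tot A B → E.Base)) [e.IsLinear ℂ]
    (hp : p ∈ e.baseSet) (v : E.Fib A B p) : ‖v‖ = ‖(e ⟨p, v⟩).2‖ * ‖e.symm p 1‖ := by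
  have h : v = (e ⟨p, v⟩).2 • e.symm p 1 := by
    apply (e.linearEquivAt ℂ p hp).injective
    rw [map_smul]
    simp [e.apply_mk_symm hp]
  conv_lhs => rw [h, norm_smul]

theorem contAt_symm {p : E.Base}
    (e : Trivialization ℂ (TotalSpace.proj : E.Tot A B → E.Base))
    (hp : p ∈ e.baseSet) : ContinuousAt (fun q => (⟨q, e.symm q 1⟩ : E.Tot A B)) p := by
  rw [contSection_iff _ e hp]
  refine (continuousAt_const (y := (1 : ℂ))).congr ?_
  filter_upwards [e.open_baseSet.mem_nhds hp] with q hq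
  rw [e.apply_mk_symm hq]

theorem symm_one_ne_zero {p : E.Base}
    (e : Trivialization ℂ (TotalSpace.proj : E.Tot A B → E.Base)) [e.IsLinear ℂ]
    (hp : p ∈ e.baseSet) : e.symm p (1 : ℂ) ≠ 0 := by
  intro h
  have h1 : (e ⟨p, e.symm p (1 : ℂ)⟩).2 = 1 := by rw [e.apply_mk_symm hp]
  rw [h] at h1
  exact zero_ne_one ((e.linear ℂ hp).map_zero.symm.trans h1)

theorem IsContSection.contAt_smul {σ : ∀ p, E.Fib A B p} {f : E.Base → ℂ} {p : E.Base}
    (hE : IsSpaceoid E)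
    (hσ : ContinuousAt (fun p => (⟨p, σ p⟩ : E.Tot A B)) p) (hf : ContinuousAt f p) :
    ContinuousAt (fun p => (⟨p, f p • σ p⟩ : E.Tot A B)) p := by
  obtain ⟨e, hp, he⟩ := hE.locally_trivial A B p
  rw [contSection_iff _ e hp] at hσ ⊢
  refine (hf.mul hσ).congr ?_
  filter_upwards [e.open_baseSet.mem_nhds hp] with q hq
  exact ((e.linear ℂ hq).map_smul _ _).symm

theorem IsContSection.smul_fun (hE : IsSpaceoid E) {σ : ∀ p, E.Fib A B p} {f : E.Base → ℂ}
    (hf : Continuous f) (hσ : IsContSection σ) : IsContSection fun p => f p • σ p := by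
  rw [IsContSection, continuous_iff_continuousAt] at *
  exact fun p => contAt_smul hE (hσ p) (hf p)

theorem IsContSection.continuous_norm (hE : IsSpaceoid E) {σ : ∀ p, E.Fib A B p}
    (hσ : IsContSection σ) : Continuous fun p => ‖σ p‖ :=
  (hE.continuous_norm A B).comp hσ

theorem IsContSection.sub (hE : IsSpaceoid E) {σ τ : ∀ p, E.Fib A B p}
    (hσ : IsContSection σ) (hτ : IsContSection τ) : IsContSection fun p => σ p - τ p := by
  simpa [sub_eq_add_neg] using hσ.add hE (hτ.smul hE (-1))

/-- In a local trivialization the coefficient is the quotient of the coordinates of σ and of the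
unit section, and the latter has no zeros because ‖1‖ = 1. -/
theorem IsContSection.continuous_coef (hE : IsSpaceoid E) {σ : ∀ p, E.Fib A A p}
    (hσ : IsContSection σ) : Continuous fun p => hE.coef (σ p) := by
  rw [continuous_iff_continuousAt]
  intro p
  obtain ⟨e, hp, he⟩ := hE.locally_trivial A A p
  have h1 := hσ.loc e hp
  have h2 := (IsContSection.one (A := A) hE).loc e hp
  have key : ∀ q ∈ e.baseSet, (e ⟨q, σ q⟩).2 = hE.coef (σ q) * (e ⟨q, E.one A q⟩).2 := by
    intro q hq
    have := (e.linear ℂ hq).map_smul (hE.coef (σ q)) (E.one A q)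
    rwa [hE.coef_smul_one] at this
  have hne : ∀ q ∈ e.baseSet, (e ⟨q, E.one A q⟩).2 ≠ 0 := by
    intro q hq h
    have := norm_eq_norm_coord_mul e hq (E.one A q)
    rw [h, hE.norm_one] at this
    simp at this
  refine (h1.div h2 (hne p hp)).congr ?_
  filter_upwards [e.open_baseSet.mem_nhds hp] with q hq
  rw [Pi.div_apply, key q hq, mul_div_cancel_right₀ _ (hne q hq)]

/-- Every element of a fibre is the value of a continuous section. -/
theorem exists_isContSection (hE : IsSpaceoid E) {p : E.Base} (v : E.Fib A B p) :
    ∃ σ : ∀ q, E.Fib A B q, IsContSection σ ∧ σ p = v := by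
  have := hE.compact
  have := hE.hausdorff
  obtain ⟨e, hp, he⟩ := hE.locally_trivial A B p
  -- The bump function is supported in a closed set `k` inside the domain of the trivialization. A
  -- point outside the domain therefore has the open neighbourhood `kᶜ`, on which the truncated
  -- frame is zero.
  obtain ⟨k, hk, hkc, hpk, hke⟩ := exists_compact_closed_between (isCompact_singleton (x := p))
    e.open_baseSet (by simpa using hp)
  obtain ⟨f, hf1, hf0, -, -⟩ := exists_continuous_one_zero_of_isCompact
    (isCompact_singleton (x := p)) (isOpen_interior (s := k)).isClosed_compl
    (by rw [Set.disjoint_compl_right_iff_subset]; exact hpk)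
  have hs : IsContSection fun q => ((f q : ℝ) : ℂ) • e.symm q (1 : ℂ) := by
    rw [IsContSection, continuous_iff_continuousAt]
    intro q
    by_cases hq : q ∈ e.baseSet
    · exact IsContSection.contAt_smul hE (contAt_symm e hq)
        (Complex.continuous_ofReal.comp f.continuous).continuousAt
    · refine (continuous_iff_continuousAt.1
        (IsContSection.zero (A := A) (B := B) hE) q).congr ?_
      have : kᶜ ∈ 𝓝 q := hkc.isOpen_compl.mem_nhds fun h => hq (hke h)
      filter_upwards [this] with r hr
      have : f r = 0 := hf0 (fun h => hr (interior_subset h))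
      simp [this]
  obtain ⟨c, hc⟩ := (hE.toSpanSingleton_bijective (symm_one_ne_zero e hp)).2 v
  refine ⟨_, hs.smul hE c, ?_⟩
  have : f p = 1 := hf1 rfl
  simpa [this] using hc

/-- Convergence in the total space, in terms of a continuous section through the limit. -/
theorem tendsto_tot_iff (hE : IsSpaceoid E) {ι : Type*} {l : Filter ι} {F : ι → E.Tot A B}
    {σ : ∀ q, E.Fib A B q} (hσ : IsContSection σ) (p : E.Base) :
    Tendsto F l (𝓝 ⟨p, σ p⟩) ↔ Tendsto (fun z => (F z).1) l (𝓝 p) ∧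
      Tendsto (fun z => ‖(F z).2 - σ (F z).1‖) l (𝓝 0) := by
  obtain ⟨e, hp, he⟩ := hE.locally_trivial A B p
  rw [e.tendsto_nhds_iff (e.mem_source.2 hp)]
  refine and_congr_right fun h1 => ?_
  have h1 : Tendsto (fun z => (F z).1) l (𝓝 p) := h1
  have hb : ∀ᶠ z in l, (F z).1 ∈ e.baseSet := h1 (e.open_baseSet.mem_nhds hp)
  have hn : Tendsto (fun z => ‖e.symm (F z).1 (1 : ℂ)‖) l (𝓝 ‖e.symm p (1 : ℂ)‖) :=
    ((hE.continuous_norm A B).continuousAt.comp (contAt_symm e hp)).tendsto.comp h1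
  have hn0 : ‖e.symm p (1 : ℂ)‖ ≠ 0 := norm_ne_zero_iff.2 (symm_one_ne_zero e hp)
  have hσ' : Tendsto (fun z => (e ⟨(F z).1, σ (F z).1⟩).2) l (𝓝 (e ⟨p, σ p⟩).2) :=
    (hσ.loc e hp).tendsto.comp h1
  -- Fibre distance and coordinate distance differ by the norm of the frame, which converges to a
  -- nonzero limit; so one tends to zero exactly when the other does.
  have key : ∀ᶠ z in l, ‖(F z).2 - σ (F z).1‖ =
      ‖(e (F z)).2 - (e ⟨(F z).1, σ (F z).1⟩).2‖ * ‖e.symm (F z).1 (1 : ℂ)‖ := by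
    filter_upwards [hb] with z hz
    rw [norm_eq_norm_coord_mul e hz]
    congr 2
    exact (e.linear ℂ hz).map_sub _ _
  have h2 : Tendsto (fun z => (e (F z)).2) l (𝓝 (e ⟨p, σ p⟩).2) ↔
      Tendsto (fun z => ‖(e (F z)).2 - (e ⟨(F z).1, σ (F z).1⟩).2‖) l (𝓝 0) := by
    rw [← tendsto_zero_iff_norm_tendsto_zero]
    constructor
    · intro h
      simpa using h.sub hσ'
    · intro h
      simpa using h.add hσ'
  refine h2.trans ⟨fun h => ?_, fun h => ?_⟩
  · simpa using (h.mul hn).congr' (key.mono fun z hz => hz.symm)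
  · have h3 := h.div hn hn0
    rw [zero_div] at h3
    refine h3.congr' ?_
    filter_upwards [key, hb] with z hz hz'
    rw [Pi.div_apply, hz, mul_div_cancel_right₀ _ (norm_ne_zero_iff.2 (symm_one_ne_zero e hz'))]

end Sections

/-! ## `Γ(E)` is a commutative full C*-category -/

section Frames

variable {E : SpaceoidData.{u}} {A B : E.Ind}

/-- A family of sections without common zeros contains a finite one. -/
theorem exists_finset_ne_zero (hE : IsSpaceoid E) {ι : Type*} {s : ι → ∀ p, E.Fib A B p}
    (hs : ∀ i, IsContSection (s i)) (h0 : ∀ p, ∃ i, s i p ≠ 0) :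
    ∃ t : Finset ι, ∀ p, ∃ i ∈ t, s i p ≠ 0 := by
  have := hE.compact
  obtain ⟨t, ht⟩ := isCompact_univ.elim_finite_subcover (fun i => {p | s i p ≠ 0})
    (fun i => by
      have : {p | s i p ≠ 0} = {p | ‖s i p‖ ≠ 0} := by simp
      rw [this]
      exact isOpen_ne_fun ((hs i).continuous_norm hE) continuous_const)
    (fun p _ => Set.mem_iUnion.2 (h0 p))
  refine ⟨t, fun p => ?_⟩
  obtain ⟨i, hi, hp⟩ := Set.mem_iUnion₂.1 (ht (Set.mem_univ p))
  exact ⟨i, hi, hp⟩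

/-- Finitely many sections without common zeros generate all sections as a module over the
continuous functions. -/
theorem exists_eq_sum_smul (hE : IsSpaceoid E) {ι : Type*} {s : ι → ∀ p, E.Fib A B p}
    (hs : ∀ i, IsContSection (s i)) {t : Finset ι} (ht : ∀ p, ∃ i ∈ t, s i p ≠ 0)
    {τ : ∀ p, E.Fib A B p} (hτ : IsContSection τ) :
    ∃ f : ι → E.Base → ℂ, (∀ i, Continuous (f i)) ∧ ∀ p, τ p = ∑ i ∈ t, f i p • s i p := by
  -- The coefficients are the inner products of the `s i` with τ, normalized by this sum of squares,
  -- which is nowhere zero.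
  let h : E.Base → ℝ := fun p => ∑ i ∈ t, ‖s i p‖ ^ 2
  have hh : ∀ p, h p ≠ 0 := fun p => by
    obtain ⟨i, hi, hp⟩ := ht p
    refine (Finset.sum_pos' (fun i _ => sq_nonneg _) ⟨i, hi, ?_⟩).ne'
    have := norm_pos_iff.2 hp
    positivity
  have hc : Continuous h :=
    continuous_finsetSum t fun i _ => ((hs i).continuous_norm hE).pow 2
  refine ⟨fun i p => hE.coef (E.mul (E.adj (s i p)) (τ p)) / (h p : ℂ), fun i => ?_, fun p => ?_⟩
  · exact ((((hs i).adj hE).mul hE hτ).continuous_coef hE).div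
      (Complex.continuous_ofReal.comp hc) fun p => Complex.ofReal_ne_zero.2 (hh p)
  -- By associativity s (s* τ) = (s s*) τ = ‖s‖² τ, so the `i`-th term is the fraction ‖s_i‖² / h of
  -- τ itself, and the fractions add up to 1.
  · have h1 : ∀ i, (hE.coef (E.mul (E.adj (s i p)) (τ p)) / (h p : ℂ)) • s i p =
        (((‖s i p‖ ^ 2 : ℝ) : ℂ) / (h p : ℂ)) • τ p := fun i => by
      rw [div_eq_inv_mul, mul_smul, hE.coef_smul_mul', ← hE.mul_assoc, ← hE.coef_smul_mul,
        hE.coef_mul_adj_self, smul_smul, div_eq_inv_mul]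
    have hh' : (h p : ℂ) ≠ 0 := Complex.ofReal_ne_zero.2 (hh p)
    simp_rw [h1]
    rw [← Finset.sum_smul, ← Finset.sum_div, ← Complex.ofReal_sum]
    change τ p = ((h p : ℂ) / (h p : ℂ)) • τ p
    rw [div_self hh', one_smul]

end Frames

namespace Sec

variable {E : Spaceoid.{u}} {A B : E.Ind}

/-- The element of `Γ(E)_{AB}` given by a continuous section. -/
def ofCont (σ : ∀ p, E.Fib A B p) (hσ : IsContSection (E := E.toSpaceoidData) σ) : Sec E A B :=
  ⟨σ, hσ⟩

/-- The evaluation of sections at a point. -/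
def evalAt (E : Spaceoid.{u}) (A B : E.Ind) (p : E.Base) : Sec E A B →ₗ[ℂ] E.Fib A B p where
  toFun σ := σ.1 p
  map_add' _ _ := rfl
  map_smul' _ _ := rfl

theorem sum_apply {ι : Type*} (t : Finset ι) (s : ι → Sec E A B) (p : E.Base) :
    (∑ i ∈ t, s i).1 p = ∑ i ∈ t, (s i).1 p :=
  map_sum (evalAt E A B p) s t

theorem evalAt_surjective (p : E.Base) : Function.Surjective (evalAt E A B p) := fun v => by
  obtain ⟨σ, hσ, h⟩ := exists_isContSection E.property v
  exact ⟨⟨σ, hσ⟩, h⟩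

theorem norm_le {σ : Sec E A B} {M : ℝ} (hM : 0 ≤ M) (h : ∀ p, ‖σ.1 p‖ ≤ M) : ‖σ‖ ≤ M :=
  Real.iSup_le h hM

/-- A Cauchy sequence converges fibrewise and uniformly. The limit is continuous because near each
point it can be compared with a continuous section through its value there. -/
theorem completeSpace : CompleteSpace (Sec E A B) := by
  refine Metric.complete_of_cauchySeq_tendsto fun s hs => ?_
  have hsub : ∀ p m n, ‖(s m).1 p - (s n).1 p‖ ≤ ‖s m - s n‖ := fun p m n =>
    norm_apply_le (s m - s n) p
  have hp : ∀ p, ∃ v, Tendsto (fun n => (s n).1 p) atTop (𝓝 v) := by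
    intro p
    have := E.property.complete A B p
    refine cauchySeq_tendsto_of_complete ?_
    rw [Metric.cauchySeq_iff] at hs ⊢
    intro ε hε
    obtain ⟨N, hN⟩ := hs ε hε
    refine ⟨N, fun m hm n hn => ?_⟩
    have := hN m hm n hn
    rw [dist_eq_norm] at this ⊢
    exact (hsub p m n).trans_lt this
  choose τ hτ using hp
  have hunif : ∀ ε > 0, ∃ N, ∀ n ≥ N, ∀ p, ‖(s n).1 p - τ p‖ ≤ ε := by
    intro ε hε
    obtain ⟨N, hN⟩ := Metric.cauchySeq_iff.1 hs ε hε
    refine ⟨N, fun n hn p => ?_⟩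
    refine le_of_tendsto ((tendsto_const_nhds.sub (hτ p)).norm) ?_
    filter_upwards [eventually_ge_atTop N] with m hm
    have := hN n hn m hm
    rw [dist_eq_norm] at this
    exact (hsub p n m).trans this.le
  have hcont : IsContSection τ := by
    rw [IsContSection, continuous_iff_continuousAt]
    intro p
    obtain ⟨ρ, hρ, hρp⟩ := exists_isContSection E.property (τ p)
    rw [ContinuousAt, ← hρp, tendsto_tot_iff E.property hρ]
    refine ⟨tendsto_id, ?_⟩
    rw [Metric.tendsto_nhds]
    intro ε hε
    obtain ⟨N, hN⟩ := hunif (ε / 3) (by positivity)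
    have hc := ((s N).2.sub E.property hρ).continuous_norm E.property
    -- Since ρ and τ agree at `p`, the left side is at most ε/3 there. By continuity it stays below
    -- 2ε/3 nearby, which leaves ε/3 for the uniform error.
    have h1 : ‖(s N).1 p - ρ p‖ < 2 * ε / 3 := by
      rw [hρp]
      exact (hN N le_rfl p).trans_lt (by linarith)
    filter_upwards [hc.continuousAt.eventually_lt_const h1] with q hq
    rw [dist_zero_right, norm_norm]
    calc ‖τ q - ρ q‖ ≤ ‖(s N).1 q - τ q‖ + ‖(s N).1 q - ρ q‖ := by
          rw [norm_sub_rev ((s N).1 q) (τ q)]; exact norm_sub_le_norm_sub_add_norm_sub _ _ _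
      _ < ε / 3 + 2 * ε / 3 := add_lt_add_of_le_of_lt (hN N le_rfl q) hq
      _ = ε := by ring
  refine ⟨ofCont τ hcont, ?_⟩
  rw [Metric.tendsto_atTop]
  intro ε hε
  obtain ⟨N, hN⟩ := hunif (ε / 2) (by positivity)
  refine ⟨N, fun n hn => ?_⟩
  rw [dist_eq_norm]
  exact (norm_le (by positivity) (hN n hn)).trans_lt (by linarith)

/-- The supremum commutes with squaring. The product enters as a section τ with prescribed values,
so that the statement applies directly to composition in Γ(E). -/
theorem norm_adj_mul_self (σ : Sec E A B)
    (τ : Sec E B B) (h : ∀ p, τ.1 p = E.mul (E.adj (σ.1 p)) (σ.1 p)) : ‖τ‖ = ‖σ‖ ^ 2 := by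
  have h' : ∀ p, ‖τ.1 p‖ = ‖σ.1 p‖ ^ 2 := fun p => by rw [h, E.property.norm_adj_mul]
  refine le_antisymm (norm_le (by positivity) fun p => ?_) ?_
  · rw [h']
    exact pow_le_pow_left₀ (norm_nonneg _) (norm_apply_le σ p) 2
  · have : ‖σ‖ ≤ √‖τ‖ := norm_le (Real.sqrt_nonneg _) fun p =>
      Real.le_sqrt_of_sq_le ((h' p).symm.trans_le (norm_apply_le τ p))
    calc ‖σ‖ ^ 2 ≤ √‖τ‖ ^ 2 := pow_le_pow_left₀ (norm_nonneg _) this 2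
      _ = ‖τ‖ := Real.sq_sqrt (norm_nonneg _)

theorem norm_mul_le {C : E.Ind} (σ : Sec E A B) (τ : Sec E B C)
    (ρ : Sec E A C) (h : ∀ p, ρ.1 p = E.mul (σ.1 p) (τ.1 p)) : ‖ρ‖ ≤ ‖τ‖ * ‖σ‖ := by
  refine norm_le (mul_nonneg (norm_nonneg _) (norm_nonneg _)) fun p => ?_
  rw [h p, mul_comm]
  exact (E.property.norm_mul_le _ _).trans (mul_le_mul (norm_apply_le σ p) (norm_apply_le τ p)
    (norm_nonneg _) (norm_nonneg _))

/-- The continuous section p ↦ ‖σ_p‖ 1 is a square root of σ*σ, since the coefficient of σ_p*σ_p is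
‖σ_p‖². -/
theorem exists_adj_mul_self (σ : Sec E A B) : ∃ τ : Sec E B B, ∀ p,
    E.mul (E.adj (σ.1 p)) (σ.1 p) = E.mul (E.adj (τ.1 p)) (τ.1 p) := by
  refine ⟨ofCont (fun p => ((‖σ.1 p‖ : ℝ) : ℂ) • E.one B p) (IsContSection.smul_fun E.property
    (Complex.continuous_ofReal.comp (σ.2.continuous_norm E.property))
    (IsContSection.one E.property)), fun p => E.property.coef_injective ?_⟩
  rw [E.property.coef_adj_mul_self, E.property.coef_adj_mul_self]
  change _ = (((‖((‖σ.1 p‖ : ℝ) : ℂ) • E.one B p‖) ^ 2 : ℝ) : ℂ)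
  rw [norm_smul, E.property.norm_one, Complex.norm_real, norm_norm, mul_one]

/-- The span is everything, not only dense. Every point has a section x with x*x ≠ 0 there, so
finitely many x*x generate all sections over the continuous functions; a coefficient f is absorbed
by f (x*x) = x*(f x). -/
theorem mem_span_adj_mul (τ : Sec E B B) :
    τ ∈ Submodule.span ℂ {z : Sec E B B | ∃ x y : Sec E A B,
      ∀ p, z.1 p = E.mul (E.adj (x.1 p)) (y.1 p)} := by
  have hE := E.property
  obtain ⟨t, ht⟩ := exists_finset_ne_zero hE
    (s := fun (x : Sec E A B) p => E.mul (E.adj (x.1 p)) (x.1 p))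
    (fun x => (x.2.adj hE).mul hE x.2) fun p => by
      have := hE.nontrivial A B p
      obtain ⟨v, hv⟩ := exists_ne (0 : E.Fib A B p)
      obtain ⟨σ, hσ⟩ := evalAt_surjective p v
      change σ.1 p = v at hσ
      refine ⟨σ, ?_⟩
      rw [← norm_ne_zero_iff, hE.norm_adj_mul, hσ]
      exact pow_ne_zero 2 (norm_ne_zero_iff.2 hv)
  obtain ⟨f, hf, h⟩ := exists_eq_sum_smul hE (fun x : Sec E A B => (x.2.adj hE).mul hE x.2) ht τ.2
  have h1 : τ = ∑ x ∈ t, ofCont (fun p => f x p • E.mul (E.adj (x.1 p)) (x.1 p))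
      (IsContSection.smul_fun hE (hf x) ((x.2.adj hE).mul hE x.2)) := by
    ext p
    rw [h p, sum_apply]
    rfl
  rw [h1]
  refine sum_mem fun x _ => Submodule.subset_span ⟨x, ofCont (fun p => f x p • x.1 p)
    (IsContSection.smul_fun hE (hf x) x.2), fun p => ?_⟩
  exact (hE.mul_smul _ _ _).symm

end Sec

theorem secData_isCStarCat (E : Spaceoid.{u}) : IsCStarCat (secData E) where
  complete _ _ := Sec.completeSpace
  add_comp _ _ _ := Sec.ext fun _ => E.property.mul_add _ _ _
  comp_add _ _ _ := Sec.ext fun _ => E.property.add_mul _ _ _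
  smul_comp _ _ _ := Sec.ext fun _ => E.property.mul_smul _ _ _
  comp_smul _ _ _ := Sec.ext fun _ => E.property.smul_mul _ _ _
  adj_add _ _ := Sec.ext fun _ => E.property.adj_add _ _
  adj_smul _ _ := Sec.ext fun _ => E.property.adj_smul _ _
  adj_adj _ := Sec.ext fun _ => E.property.adj_adj _
  adj_id A := Sec.ext fun _ => E.property.adj_one A _
  adj_comp _ _ := Sec.ext fun _ => E.property.adj_mul _ _
  norm_comp_le x y := Sec.norm_mul_le y x _ fun _ => rfl
  norm_comp_adj {A B} x := Sec.norm_adj_mul_self (E := E) (A := B) (B := A) x _ fun _ => rfl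
  positive x := by
    obtain ⟨y, hy⟩ := Sec.exists_adj_mul_self (E := E) x
    exact ⟨y, Sec.ext hy⟩

theorem secData_isFullCat (E : Spaceoid.{u}) : IsFullCat (secData E) := by
  intro A B
  constructor
  · refine Dense.mono (s₁ := Set.univ) (fun τ _ => ?_) dense_univ
    refine Submodule.span_mono ?_ (Sec.mem_span_adj_mul (A := A) (E := E) τ)
    rintro z ⟨x, y, h⟩
    exact ⟨x, y, Sec.ext h⟩
  · refine Dense.mono (s₁ := Set.univ) (fun τ _ => ?_) dense_univ
    refine Submodule.span_mono ?_ (Sec.mem_span_adj_mul (A := B) (E := E) τ)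
    rintro z ⟨x, y, h⟩
    -- The products x y* are the products x* y with the two objects exchanged and both factors
    -- replaced by their adjoints.
    refine ⟨(secData E).adj x, (secData E).adj y, Sec.ext fun p => (h p).trans ?_⟩
    exact congrArg (E.mul _) (E.property.adj_adj _).symm

theorem secData_isFullCommCStarCat (E : Spaceoid.{u}) : IsFullCommCStarCat (secData E) where
  nonempty := E.property.nonempty
  isCStarCat := secData_isCStarCat E
  isCommutative _ _ _ := Sec.ext fun _ => E.property.mul_comm _ _
  isFull := secData_isFullCat E

theorem secMap_add {E₁ E₂ : Spaceoid.{u}} (f : E₁ ⟶ E₂) {A B : E₂.Ind} (σ τ : Sec E₂ A B) :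
    secMap f (σ + τ) = secMap f σ + secMap f τ :=
  Sec.ext fun p => map_add (f.data.fib A B p) _ _

theorem secMap_smul {E₁ E₂ : Spaceoid.{u}} (f : E₁ ⟶ E₂) {A B : E₂.Ind} (c : ℂ)
    (σ : Sec E₂ A B) : secMap f (c • σ) = c • secMap f σ :=
  Sec.ext fun p => map_smul (f.data.fib A B p) _ _

theorem gammaIsFunctor : GammaIsFunctor.{u} where
  obj := secData_isFullCommCStarCat
  map f :=
    { map_add := secMap_add f
      map_smul := secMap_smul f
      map_adj := fun _ => Sec.ext fun _ => f.property.fib_adj _ _ _ _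
      bijective := f.data.ind.symm.bijective }
  map_id _ := rfl
  map_comp _ _ := rfl

/-! ## The endomorphism algebras of a commutative C*-category -/

namespace IsCStarCat

variable {C : StarCatData.{u}} (hC : IsCStarCat C) {A B D : C.Obj}

include hC

theorem zero_comp (x : B ⟶ D) : (0 : A ⟶ B) ≫ x = 0 := by
  simpa using hC.smul_comp 0 (0 : A ⟶ B) x

theorem comp_zero (x : A ⟶ B) : x ≫ (0 : B ⟶ D) = 0 := by
  simpa using hC.comp_smul 0 x (0 : B ⟶ D)

/-- The C*-identity gives ‖1‖ = ‖1‖². Only an inequality is claimed because the hom-sets may all be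
zero. -/
theorem norm_id_le (A : C.Obj) : ‖𝟙 A‖ ≤ 1 := by
  have h := hC.norm_comp_adj (𝟙 A)
  rw [hC.adj_id, Category.comp_id] at h
  nlinarith [norm_nonneg (𝟙 A)]

end IsCStarCat

/-- The algebra `C_{AA}`. -/
def EndAlg (C : FullCommCStarCat.{u}) (A : C.Obj) : Type u := A ⟶ A

namespace EndAlg

variable (C : FullCommCStarCat.{u}) (A : C.Obj)

instance : NormedAddCommGroup (EndAlg C A) := inferInstanceAs (NormedAddCommGroup (A ⟶ A))

instance : NormedSpace ℂ (EndAlg C A) := inferInstanceAs (NormedSpace ℂ (A ⟶ A))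

instance : NormedCommRing (EndAlg C A) :=
  { (inferInstance : NormedAddCommGroup (EndAlg C A)) with
    mul := fun (f g : A ⟶ A) => g ≫ f
    one := 𝟙 A
    mul_assoc := fun f g h => (Category.assoc (obj := C.Obj) (X := A) (Y := A) h g f).symm
    one_mul := fun f => Category.comp_id (obj := C.Obj) (X := A) (Y := A) f
    mul_one := fun f => Category.id_comp (obj := C.Obj) (X := A) (Y := A) f
    left_distrib := fun f g h => C.property.isCStarCat.add_comp (A := A) (B := A) g h f
    right_distrib := fun f g h => C.property.isCStarCat.comp_add (A := A) (B := A) h f g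
    zero_mul := fun f => C.property.isCStarCat.comp_zero (A := A) (B := A) f
    mul_zero := fun f => C.property.isCStarCat.zero_comp (A := A) (B := A) f
    mul_comm := fun f g => C.property.isCommutative A g f
    norm_mul_le := fun f g =>
      (C.property.isCStarCat.norm_comp_le (A := A) (B := A) g f).trans (mul_comm _ _).le }

instance : NormedAlgebra ℂ (EndAlg C A) :=
  { Algebra.ofModule (R := ℂ) (A := EndAlg C A)
      (fun c f g => C.property.isCStarCat.comp_smul (A := A) (B := A) c g f)
      (fun c f g => C.property.isCStarCat.smul_comp (A := A) (B := A) c g f) with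
    norm_smul_le := fun c f => (norm_smul c f).le }

instance : StarRing (EndAlg C A) where
  star (f : A ⟶ A) := C.adj f
  star_involutive := C.property.isCStarCat.adj_adj (A := A) (B := A)
  star_mul f g := C.property.isCStarCat.adj_comp (A := A) (B := A) g f
  star_add := C.property.isCStarCat.adj_add (A := A) (B := A)

/-- This gives access to commutative Gel'fand theory for C_{AA}. The product f g is `g ≫ f`, so f* f
is `f ≫ C.adj f` and the C*-identity of the category applies. -/
instance : CommCStarAlgebra (EndAlg C A) :=
  { (inferInstance : NormedCommRing (EndAlg C A)), (inferInstance : NormedAlgebra ℂ (EndAlg C A)),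
    (inferInstance : StarRing (EndAlg C A)) with
    complete := (C.property.isCStarCat.complete A A).complete
    star_smul := C.property.isCStarCat.adj_smul (A := A) (B := A)
    norm_mul_self_le := fun f => by
      rw [← sq]
      exact (C.property.isCStarCat.norm_comp_adj (A := A) (B := A) f).ge }

variable {C A}

/-- An endomorphism of `A`, as an element of the algebra `C_{AA}`. -/
def of (a : A ⟶ A) : EndAlg C A := a

variable (χ : characterSpace ℂ (EndAlg C A))

theorem char_comp (a b : A ⟶ A) : χ (of (a ≫ b)) = χ (of a) * χ (of b) :=
  (map_mul χ (of b) (of a)).trans (mul_comm _ _)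

theorem char_adj (a : A ⟶ A) : χ (of (C.adj a)) = conj (χ (of a)) := map_star χ (of a)

theorem char_id : χ (of (𝟙 A)) = 1 := map_one χ

theorem char_add (a b : A ⟶ A) : χ (of (a + b)) = χ (of a) + χ (of b) := map_add χ (of a) (of b)

theorem char_smul (c : ℂ) (a : A ⟶ A) : χ (of (c • a)) = c * χ (of a) := map_smul χ c (of a)

/-- This is the isometric half of Gel'fand's theorem for C_{AA}; the surjective half follows. -/
theorem norm_le_of_char {a : A ⟶ A} {M : ℝ} (hM : 0 ≤ M)
    (h : ∀ χ : characterSpace ℂ (EndAlg C A), ‖χ (of a)‖ ≤ M) : ‖a‖ ≤ M := by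
  have h1 := (gelfandTransform_isometry (EndAlg C A)).norm_map_of_map_zero (map_zero _) (of a)
  have h2 : ‖of a‖ = ‖a‖ := rfl
  rw [← h2, ← h1]
  exact (ContinuousMap.norm_le _ hM).2 h

theorem exists_char_eq (f : C(characterSpace ℂ (EndAlg C A), ℂ)) :
    ∃ a : A ⟶ A, ∀ χ : characterSpace ℂ (EndAlg C A), χ (of a) = f χ := by
  obtain ⟨a, ha⟩ := (gelfandTransform_bijective (EndAlg C A)).2 f
  exact ⟨a, fun χ => DFunLike.congr_fun ha χ⟩

end EndAlg

open EndAlg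

/-! ## Characters and `ℂ`-valued *-functors -/

section Characters

variable {C : FullCommCStarCat.{u}} {O : C.Obj}

/-- The Hilbert module `C_{AO}` does not vanish at a character of `C_{OO}`. -/
theorem exists_char_comp_adj_eq_one (χ : characterSpace ℂ (EndAlg C O)) (A : C.Obj) :
    ∃ x : O ⟶ A, χ (of (x ≫ C.adj x)) = 1 := by
  have hC := C.property.isCStarCat
  have h1 : ∃ x : O ⟶ A, χ (of (x ≫ C.adj x)) ≠ 0 := by
    by_contra! h
    -- Polarization: if χ kills every x*x, then it kills every inner product x*y. By fullness and
    -- continuity it is then zero, against χ(1) = 1.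
    have h2 : ∀ x y : O ⟶ A, χ (of (y ≫ C.adj x)) = 0 := by
      intro x y
      have h3 := h (x + y)
      have h4 := h (x + Complex.I • y)
      simp only [hC.adj_add, hC.adj_smul, hC.add_comp, hC.comp_add, hC.smul_comp, hC.comp_smul,
        char_add, char_smul, h, Complex.conj_I] at h3 h4
      linear_combination (1 / 2 : ℂ) * h3 - (Complex.I / 2) * h4 +
        (1 / 2 : ℂ) * (χ (of (y ≫ C.adj x)) - χ (of (x ≫ C.adj y))) * Complex.I_sq
    have h5 : ∀ z : EndAlg C O, χ z = 0 := by
      have hcl : IsClosed {z : EndAlg C O | χ z = 0} :=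
        isClosed_singleton.preimage (map_continuous χ)
      intro z
      refine hcl.closure_subset_iff.2 ?_ ((C.property.isFull A O).1 z)
      intro w hw
      refine Submodule.span_induction (p := fun (w : O ⟶ O) _ => χ (of w) = 0) ?_ ?_ ?_ ?_ hw
      · rintro _ ⟨x, y, rfl⟩
        exact h2 x y
      · exact map_zero χ
      · intro a b _ _ ha hb
        rw [char_add, ha, hb, add_zero]
      · intro c a _ ha
        rw [char_smul, ha, mul_zero]
    exact one_ne_zero ((char_id χ).symm.trans (h5 _))
  obtain ⟨x, hx⟩ := h1
  -- Positivity makes χ(x*x) = |χ(y)|² a positive number, so rescaling `x` by 1/|χ(y)| normalizes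
  -- it.
  obtain ⟨y, hy⟩ := hC.positive x
  have h2 : χ (of (x ≫ C.adj x)) = ((‖χ (of y)‖ ^ 2 : ℝ) : ℂ) := by
    rw [hy, char_comp, char_adj, Complex.mul_conj, Complex.normSq_eq_norm_sq]
  have h3 : (‖χ (of y)‖ : ℂ) ≠ 0 := by
    intro h0
    apply hx
    rw [h2]
    push_cast
    rw [h0]
    simp
  refine ⟨(‖χ (of y)‖ : ℂ)⁻¹ • x, ?_⟩
  rw [hC.adj_smul, hC.smul_comp, hC.comp_smul, char_smul, char_smul, h2]
  simp only [map_inv₀, Complex.conj_ofReal]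
  push_cast
  field_simp

/-- At χ the element x x* of C_{BB} may be inserted between two factors as if it were the unit.
After multiplying by powers of x*x, which χ sends to 1, this follows from commutativity of C_{BB},
not of C_{OO}. It yields the multiplicativity of the extended functor. -/
theorem char_comp_eq (χ : characterSpace ℂ (EndAlg C O)) {B : C.Obj} {x : O ⟶ B}
    (hx : χ (of (x ≫ C.adj x)) = 1) (v : O ⟶ B) (w : B ⟶ O) :
    χ (of (v ≫ w)) = χ (of (v ≫ C.adj x)) * χ (of (x ≫ w)) := by
  have h : (v ≫ w) ≫ (x ≫ C.adj x) ≫ (x ≫ C.adj x) =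
      (v ≫ C.adj x) ≫ (x ≫ w) ≫ (x ≫ C.adj x) := by
    have := C.property.isCommutative B (w ≫ x) (C.adj x ≫ x)
    calc (v ≫ w) ≫ (x ≫ C.adj x) ≫ (x ≫ C.adj x) =
        v ≫ ((w ≫ x) ≫ (C.adj x ≫ x)) ≫ C.adj x := by simp only [Category.assoc]
      _ = _ := by rw [this]; simp only [Category.assoc]
  have h2 := congrArg (fun z => χ (of z)) h
  simpa only [char_comp χ (v ≫ w), char_comp χ (v ≫ C.adj x), char_comp χ (x ≫ C.adj x),
    char_comp χ (x ≫ w), hx, mul_one] using h2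

/-- Every character of `C_{OO}` extends to a `ℂ`-valued *-functor. -/
theorem exists_cfunctor_extending (χ : characterSpace ℂ (EndAlg C O)) :
    ∃ ω : CFunctor C.toStarCatData, ∀ a : O ⟶ O, ω.toFun a = χ (of a) := by
  have hC := C.property.isCStarCat
  -- At χ the arrows x_A behave like unitaries from O to A; they carry an arrow between any two
  -- objects to an endomorphism of O, where χ is evaluated.
  choose x hx using fun A => exists_char_comp_adj_eq_one χ A
  refine ⟨{
    toFun := fun {A B} =>
      { toFun := fun y => χ (of (x A ≫ y ≫ C.adj (x B)))
        map_add' := fun y z => by rw [hC.add_comp, hC.comp_add, char_add]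
        map_smul' := fun c y => by rw [hC.smul_comp, hC.comp_smul, char_smul]; rfl }
    map_id := fun A => by simp [hx]
    map_comp := fun {A B D} y z => by
      change χ (of (x A ≫ (y ≫ z) ≫ C.adj (x D))) =
        χ (of (x B ≫ z ≫ C.adj (x D))) * χ (of (x A ≫ y ≫ C.adj (x B)))
      have := char_comp_eq χ (hx B) (x A ≫ y) (z ≫ C.adj (x D))
      simp only [Category.assoc] at this ⊢
      rw [this, mul_comm]
    map_adj := fun {A B} y => by
      change χ (of (x B ≫ C.adj y ≫ C.adj (x A))) = conj (χ (of (x A ≫ y ≫ C.adj (x B))))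
      rw [← char_adj, hC.adj_comp, hC.adj_comp, hC.adj_adj, Category.assoc] }, fun a => ?_⟩
  change χ (of (x O ≫ a ≫ C.adj (x O))) = χ (of a)
  -- The choice of x_O need not be the identity: its contribution to the value on C_{OO} is χ(x_O*
  -- x_O) = 1.
  rw [char_comp, char_comp, mul_left_comm, ← char_comp, hx, mul_one]

end Characters

namespace CFunctor

variable {C : FullCommCStarCat.{u}} (ω : CFunctor C.toStarCatData) {A B : C.Obj}

theorem apply_comp_adj (x : A ⟶ B) : ω.toFun (x ≫ C.adj x) = ((‖ω.toFun x‖ ^ 2 : ℝ) : ℂ) := by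
  rw [ω.map_comp, ω.map_adj, ← Complex.normSq_eq_conj_mul_self, Complex.normSq_eq_norm_sq]

theorem norm_apply_le (x : A ⟶ B) : ‖ω.toFun x‖ ≤ ‖x‖ := by
  refine (ω.bound C.property.isCStarCat x).trans ?_
  refine mul_le_of_le_one_left (norm_nonneg _) ?_
  rw [Real.sqrt_le_one]
  exact C.property.isCStarCat.norm_id_le A

/-- The restriction of a `ℂ`-valued *-functor to a character of `C_{AA}`. -/
def toChar (A : C.Obj) : characterSpace ℂ (EndAlg C A) :=
  CharacterSpace.equivAlgHom.symm
    (AlgHom.ofLinearMap ((ω.toFun : (A ⟶ A) →ₗ[ℂ] ℂ) : EndAlg C A →ₗ[ℂ] ℂ) (ω.map_id A)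
      (fun f g => ω.map_comp (A := A) (B := A) (D := A) g f))

theorem toChar_apply (a : A ⟶ A) : ω.toChar A (of a) = ω.toFun a := rfl

theorem exists_ne_zero (A B : C.Obj) : ∃ x : A ⟶ B, ω.toFun x ≠ 0 := by
  obtain ⟨x, hx⟩ := exists_char_comp_adj_eq_one (ω.toChar A) B
  refine ⟨x, fun h => ?_⟩
  rw [toChar_apply, apply_comp_adj, h] at hx
  simp at hx

/-- Two `ℂ`-valued *-functors are unitarily equivalent if they agree on the endomorphisms of an
object. -/
theorem equiv_of_eq_on {ω₁ ω₂ : CFunctor C.toStarCatData} {O : C.Obj}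
    (h : ∀ a : O ⟶ O, ω₁.toFun a = ω₂.toFun a) : (unitarySetoid C.toStarCatData).r ω₁ ω₂ := by
  choose x hx using fun A => ω₁.exists_ne_zero O A
  have hn : ∀ A, ‖ω₁.toFun (x A)‖ = ‖ω₂.toFun (x A)‖ := fun A => by
    have h1 := h (x A ≫ C.adj (x A))
    rw [apply_comp_adj, apply_comp_adj, Complex.ofReal_inj] at h1
    exact (sq_eq_sq₀ (norm_nonneg _) (norm_nonneg _)).1 h1
  -- The unitary at A is the ratio of the two functors at an arrow from O to A. It is unimodular
  -- because both moduli are read off from x_A* x_A, which lies in C_{OO}.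
  refine ⟨fun A => ⟨ω₂.toFun (x A) / ω₁.toFun (x A), ?_⟩, fun A B y => ?_⟩
  · change _ ∈ Metric.sphere (0 : ℂ) 1
    rw [mem_sphere_zero_iff_norm, norm_div, hn, div_self]
    rw [← hn]
    exact norm_ne_zero_iff.2 (hx A)
  -- Intertwining at y follows by comparing the functors on the endomorphism x_A* y x_B of O.
  · have h1 := h (x B ≫ y ≫ C.adj (x A))
    simp only [map_comp, map_adj] at h1
    have h2 : conj (ω₁.toFun (x A)) * ω₁.toFun (x A) =
        conj (ω₂.toFun (x A)) * ω₂.toFun (x A) := by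
      rw [← Complex.normSq_eq_conj_mul_self, ← Complex.normSq_eq_conj_mul_self,
        Complex.normSq_eq_norm_sq, Complex.normSq_eq_norm_sq, hn]
    have hA := hx A
    have hB := hx B
    have hc : conj (ω₁.toFun (x A)) ≠ 0 := (map_ne_zero _).2 hA
    change ω₂.toFun (x A) / ω₁.toFun (x A) * ω₁.toFun y =
      ω₂.toFun y * (ω₂.toFun (x B) / ω₁.toFun (x B))
    field_simp
    refine mul_left_cancel₀ hc ?_
    linear_combination ω₂.toFun (x A) * h1 - ω₂.toFun y * ω₂.toFun (x B) * h2

theorem continuous_eval (x : A ⟶ B) :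
    Continuous fun ω : CFunctor C.toStarCatData => ω.toFun x :=
  continuous_iInf_dom (i := A) (continuous_iInf_dom (i := B) (continuous_iInf_dom (i := x)
    continuous_induced_dom))

/-- As in Tychonoff's argument, along an ultrafilter each evaluation at x stays in the disc of
radius ‖x‖ and converges. The axioms of a *-functor are equations between continuous expressions, so
they pass to the limit. -/
theorem compactSpace : CompactSpace (CFunctor C.toStarCatData) := by
  refine ⟨isCompact_iff_ultrafilter_le_nhds.2 fun 𝒰 _ => ?_⟩
  have h : ∀ {A B : C.Obj} (x : A ⟶ B), ∃ z : ℂ,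
      Tendsto (fun ω : CFunctor C.toStarCatData => ω.toFun x) 𝒰 (𝓝 z) := by
    intro A B x
    obtain ⟨z, -, hz⟩ := (isCompact_closedBall (0 : ℂ) ‖x‖).ultrafilter_le_nhds
      (𝒰.map fun ω => ω.toFun x) (by
        rw [le_principal_iff]
        refine Ultrafilter.mem_map.2 (Filter.univ_mem' fun ω => ?_)
        exact mem_closedBall_zero_iff.2 (ω.norm_apply_le x))
    exact ⟨z, hz⟩
  choose L hL using @h
  let ω₀ : CFunctor C.toStarCatData :=
    { toFun := fun {A B} =>
        { toFun := fun x => L x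
          map_add' := fun x y => tendsto_nhds_unique (hL _)
            (((hL x).add (hL y)).congr fun ω => (map_add ω.toFun x y).symm)
          map_smul' := fun c x => tendsto_nhds_unique (hL _)
            (((hL x).const_mul c).congr fun ω => (map_smul ω.toFun c x).symm) }
      map_id := fun A => tendsto_nhds_unique (hL _)
        (tendsto_const_nhds.congr fun ω => (ω.map_id A).symm)
      map_comp := fun x y => tendsto_nhds_unique (hL _)
        (((hL y).mul (hL x)).congr fun ω => (ω.map_comp x y).symm)
      map_adj := fun x => tendsto_nhds_unique (hL _)
        (((Complex.continuous_conj.tendsto _).comp (hL x)).congr fun ω => (ω.map_adj x).symm) }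
  refine ⟨ω₀, Set.mem_univ _, ?_⟩
  simp only [nhds_iInf, nhds_induced, le_iInf_iff]
  intro A B x
  exact tendsto_iff_comap.1 (hL x)

end CFunctor

/-! ## The base spectrum -/

namespace BaseSpectrum

variable {C : FullCommCStarCat.{u}}

/-- The base spectrum class of a `ℂ`-valued *-functor. -/
def mk (ω : CFunctor C.toStarCatData) : BaseSpectrum C.toStarCatData := Quotient.mk _ ω

theorem mk_surjective : Function.Surjective (mk (C := C)) := Quotient.mk_surjective

theorem mk_eq_of_eq_on {ω₁ ω₂ : CFunctor C.toStarCatData} (O : C.Obj)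
    (h : ∀ a : O ⟶ O, ω₁.toFun a = ω₂.toFun a) : mk ω₁ = mk ω₂ :=
  Quotient.sound (CFunctor.equiv_of_eq_on h)

instance compactSpace : CompactSpace (BaseSpectrum C.toStarCatData) := by
  have := CFunctor.compactSpace (C := C)
  infer_instance

/-- The restriction of classes of `ℂ`-valued *-functors to characters of `C_{OO}`. -/
def toChar (O : C.Obj) : BaseSpectrum C.toStarCatData → characterSpace ℂ (EndAlg C O) :=
  Quotient.lift (fun ω => ω.toChar O) (by
    rintro ω₁ ω₂ ⟨ν, h⟩
    refine CharacterSpace.ext fun a => ?_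
    have h1 := h O O a
    rw [mul_comm] at h1
    exact mul_right_cancel₀ (Circle.coe_ne_zero (ν O)) h1)

theorem continuous_toChar (O : C.Obj) : Continuous (toChar O) := by
  refine Continuous.quotient_lift ?_ _
  refine Continuous.subtype_mk ?_ _
  exact WeakDual.continuous_of_continuous_eval fun a => CFunctor.continuous_eval (A := O) (B := O) a

/-- A class is determined by its restriction to a single endomorphism algebra, and every character
of that algebra extends. -/
theorem bijective_toChar (O : C.Obj) : Function.Bijective (toChar O) := by
  constructor
  · intro q₁ q₂ h
    obtain ⟨ω₁, rfl⟩ := mk_surjective q₁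
    obtain ⟨ω₂, rfl⟩ := mk_surjective q₂
    exact mk_eq_of_eq_on O fun a => DFunLike.congr_fun h (of a)
  · intro χ
    obtain ⟨ω, h⟩ := exists_cfunctor_extending χ
    exact ⟨mk ω, CharacterSpace.ext fun a => h a⟩

/-- The base spectrum is homeomorphic to the spectrum of any of the algebras `C_{OO}`. -/
def homeoChar (O : C.Obj) :
    BaseSpectrum C.toStarCatData ≃ₜ characterSpace ℂ (EndAlg C O) :=
  Continuous.homeoOfEquivCompactToT2 (f := Equiv.ofBijective _ (bijective_toChar O))
    (continuous_toChar O)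

theorem t2Space : T2Space (BaseSpectrum C.toStarCatData) :=
  T2Space.of_injective_continuous (bijective_toChar (Classical.choice C.property.nonempty)).1
    (continuous_toChar _)

end BaseSpectrum

/-! ## The quotient norm -/

namespace SpecFib

variable {C : FullCommCStarCat.{u}} {A B D : C.Obj}

theorem mk_surjective (q : BaseSpectrum C.toStarCatData) :
    Function.Surjective (mk (A := A) (B := B) q) := Submodule.Quotient.mk_surjective _

theorem mk_sub (q : BaseSpectrum C.toStarCatData) (x y : B ⟶ A) : mk q (x - y) = mk q x - mk q y :=
  rfl

theorem mk_smul (q : BaseSpectrum C.toStarCatData) (c : ℂ) (x : B ⟶ A) :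
    mk q (c • x) = c • mk q x := rfl

theorem mul_mk (q : BaseSpectrum C.toStarCatData) (x : B ⟶ A) (y : D ⟶ B) :
    mul (mk q x) (mk q y) = mk q (y ≫ x) := rfl

theorem adj_mk (q : BaseSpectrum C.toStarCatData) (x : B ⟶ A) :
    adj (mk q x) = mk q (C.adj x) := rfl

theorem mk_eq_mk_iff (ω : CFunctor C.toStarCatData) (x y : B ⟶ A) :
    mk (BaseSpectrum.mk ω) x = mk (BaseSpectrum.mk ω) y ↔ ω.toFun x = ω.toFun y := by
  refine (Submodule.Quotient.eq _).trans ?_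
  rw [BaseSpectrum.mk, mem_idealAt, map_sub, sub_eq_zero]

/-- The quotient norm on `C_{AB} / I_{[ω]_{AB}}` is the absolute value of `ω`. -/
theorem norm_mk (ω : CFunctor C.toStarCatData) (x : B ⟶ A) :
    ‖mk (BaseSpectrum.mk ω) x‖ = ‖ω.toFun x‖ := by
  have hC := C.property.isCStarCat
  apply le_antisymm
  · rcases eq_or_ne (ω.toFun x) 0 with h0 | h0
    · have : mk (BaseSpectrum.mk ω) x = mk (BaseSpectrum.mk ω) 0 :=
        (mk_eq_mk_iff ω x 0).2 (by rw [h0, map_zero])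
      rw [this, h0]
      exact (norm_zero (E := SpecFib C A B (BaseSpectrum.mk ω))).trans_le (norm_nonneg _)
    · set c := ‖ω.toFun x‖ with hc
      have hc0 : 0 < c := norm_pos_iff.2 h0
      have hm : ∀ r : ℝ, 0 < max c r := fun r => lt_max_of_lt_left hc0
      -- Truncation: the transform of `h` is 1 at ω and is less than 1 exactly where |x| exceeds c =
      -- |ω(x)|. So x h lies in the class of x and has norm at most c.
      obtain ⟨h, hh⟩ := exists_char_eq (C := C) (A := B)
        { toFun := fun χ => ((c / max c √‖χ (of (x ≫ C.adj x))‖ : ℝ) : ℂ)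
          continuous_toFun := by
            refine Complex.continuous_ofReal.comp ?_
            refine continuous_const.div ?_ fun χ => (hm _).ne'
            refine continuous_const.max (Real.continuous_sqrt.comp (Continuous.norm ?_))
            exact (WeakDual.gelfandTransform ℂ (EndAlg C B) (of (x ≫ C.adj x))).continuous }
      have h1 : ω.toFun h = 1 := by
        rw [← ω.toChar_apply, hh]
        change ((c / max c √‖ω.toChar B (of (x ≫ C.adj x))‖ : ℝ) : ℂ) = 1
        rw [ω.toChar_apply, ω.apply_comp_adj, ← hc, Complex.norm_real, norm_pow, Real.norm_eq_abs,
          abs_of_pos hc0, Real.sqrt_sq hc0.le, max_self, div_self hc0.ne', Complex.ofReal_one]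
      have h2 : mk (BaseSpectrum.mk ω) x = mk (BaseSpectrum.mk ω) (h ≫ x) := by
        rw [mk_eq_mk_iff, ω.map_comp, h1, mul_one]
      have h3 : ‖h ≫ x‖ ≤ c := by
        refine le_of_sq_le_sq ?_ hc0.le
        rw [← hC.norm_comp_adj]
        refine norm_le_of_char (C := C) (sq_nonneg c) fun χ => ?_
        have : (h ≫ x) ≫ C.adj (h ≫ x) = h ≫ (x ≫ C.adj x) ≫ C.adj h := by
          rw [hC.adj_comp]; simp only [Category.assoc]
        rw [this, char_comp, char_comp, char_adj, norm_mul, norm_mul, RCLike.norm_conj, hh]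
        set r := ‖χ (of (x ≫ C.adj x))‖ with hr
        change ‖((c / max c √r : ℝ) : ℂ)‖ * (r * ‖((c / max c √r : ℝ) : ℂ)‖) ≤ c ^ 2
        rw [Complex.norm_real, Real.norm_eq_abs, abs_of_pos (div_pos hc0 (hm _))]
        have hr0 : 0 ≤ r := norm_nonneg _
        have hle : r ≤ max c √r ^ 2 := by
          calc r = √r ^ 2 := (Real.sq_sqrt hr0).symm
            _ ≤ _ := pow_le_pow_left₀ (Real.sqrt_nonneg _) (le_max_right _ _) 2
        calc c / max c √r * (r * (c / max c √r)) = c ^ 2 * (r / max c √r ^ 2) := by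
              field_simp
          _ ≤ c ^ 2 * 1 := by
              refine mul_le_mul_of_nonneg_left ?_ (sq_nonneg c)
              exact (div_le_one (pow_pos (hm _) 2)).2 hle
          _ = c ^ 2 := mul_one _
      rw [h2]
      exact (Submodule.Quotient.norm_mk_le _ _).trans h3
  -- Conversely, ω takes the same value on all representatives of the class and is contractive.
  · refine le_of_forall_pos_lt_add fun ε hε => ?_
    obtain ⟨y, hy, hlt⟩ := Submodule.Quotient.norm_mk_lt
      (S := idealAt (BaseSpectrum.mk ω) A B) (Submodule.Quotient.mk x) hε
    have h1 : ω.toFun y = ω.toFun x := (mk_eq_mk_iff ω y x).1 hy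
    rw [← h1]
    exact (ω.norm_apply_le y).trans_lt hlt

end SpecFib

/-! ## The fibres of the spectral spaceoid -/

namespace SpecFib

variable {C : FullCommCStarCat.{u}} {A B D K : C.Obj} {q : BaseSpectrum C.toStarCatData}

theorem norm_mk_le (x : B ⟶ A) : ‖mk q x‖ ≤ ‖x‖ := Submodule.Quotient.norm_mk_le _ _

theorem add_mul (e e' : SpecFib C A B q) (f : SpecFib C B D q) :
    mul (e + e') f = mul e f + mul e' f := by
  obtain ⟨x, rfl⟩ := mk_surjective q e
  obtain ⟨x', rfl⟩ := mk_surjective q e'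
  obtain ⟨y, rfl⟩ := mk_surjective q f
  exact congrArg (mk q) (C.property.isCStarCat.comp_add _ _ _)

theorem mul_add (e : SpecFib C A B q) (f f' : SpecFib C B D q) :
    mul e (f + f') = mul e f + mul e f' := by
  obtain ⟨x, rfl⟩ := mk_surjective q e
  obtain ⟨y, rfl⟩ := mk_surjective q f
  obtain ⟨y', rfl⟩ := mk_surjective q f'
  exact congrArg (mk q) (C.property.isCStarCat.add_comp _ _ _)

theorem smul_mul (c : ℂ) (e : SpecFib C A B q) (f : SpecFib C B D q) :
    mul (c • e) f = c • mul e f := by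
  obtain ⟨x, rfl⟩ := mk_surjective q e
  obtain ⟨y, rfl⟩ := mk_surjective q f
  exact congrArg (mk q) (C.property.isCStarCat.comp_smul _ _ _)

theorem mul_smul (c : ℂ) (e : SpecFib C A B q) (f : SpecFib C B D q) :
    mul e (c • f) = c • mul e f := by
  obtain ⟨x, rfl⟩ := mk_surjective q e
  obtain ⟨y, rfl⟩ := mk_surjective q f
  exact congrArg (mk q) (C.property.isCStarCat.smul_comp _ _ _)

theorem mul_assoc (e : SpecFib C A B q) (f : SpecFib C B D q) (g : SpecFib C D K q) :
    mul (mul e f) g = mul e (mul f g) := by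
  obtain ⟨x, rfl⟩ := mk_surjective q e
  obtain ⟨y, rfl⟩ := mk_surjective q f
  obtain ⟨z, rfl⟩ := mk_surjective q g
  exact congrArg (mk q) (Category.assoc _ _ _).symm

/-- The norm is |ω| and ω is multiplicative, so equality holds here and not only the inequality of a
Fell bundle. -/
theorem norm_mul (e : SpecFib C A B q) (f : SpecFib C B D q) : ‖mul e f‖ = ‖e‖ * ‖f‖ := by
  obtain ⟨ω, rfl⟩ := BaseSpectrum.mk_surjective q
  obtain ⟨x, rfl⟩ := mk_surjective _ e
  obtain ⟨y, rfl⟩ := mk_surjective _ f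
  rw [mul_mk, norm_mk, norm_mk, norm_mk, ω.map_comp, _root_.norm_mul]

theorem adj_add (e f : SpecFib C A B q) : adj (e + f) = adj e + adj f := by
  obtain ⟨x, rfl⟩ := mk_surjective q e
  obtain ⟨y, rfl⟩ := mk_surjective q f
  exact congrArg (mk q) (C.property.isCStarCat.adj_add _ _)

theorem adj_smul (c : ℂ) (e : SpecFib C A B q) : adj (c • e) = conj c • adj e := by
  obtain ⟨x, rfl⟩ := mk_surjective q e
  exact congrArg (mk q) (C.property.isCStarCat.adj_smul _ _)

theorem adj_adj (e : SpecFib C A B q) : adj (adj e) = e := by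
  obtain ⟨x, rfl⟩ := mk_surjective q e
  exact congrArg (mk q) (C.property.isCStarCat.adj_adj _)

theorem adj_mul (e : SpecFib C A B q) (f : SpecFib C B D q) :
    adj (mul e f) = mul (adj f) (adj e) := by
  obtain ⟨x, rfl⟩ := mk_surjective q e
  obtain ⟨y, rfl⟩ := mk_surjective q f
  exact congrArg (mk q) (C.property.isCStarCat.adj_comp _ _)

theorem adj_sub (e f : SpecFib C A B q) : adj (e - f) = adj e - adj f := by
  rw [eq_sub_iff_add_eq, ← adj_add, sub_add_cancel]

theorem norm_adj (e : SpecFib C A B q) : ‖adj e‖ = ‖e‖ := by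
  obtain ⟨ω, rfl⟩ := BaseSpectrum.mk_surjective q
  obtain ⟨x, rfl⟩ := mk_surjective _ e
  rw [adj_mk, norm_mk, norm_mk, ω.map_adj, RCLike.norm_conj]

theorem norm_adj_mul (e : SpecFib C A B q) : ‖mul (adj e) e‖ = ‖e‖ ^ 2 := by
  rw [norm_mul, norm_adj, sq]

theorem positive (e : SpecFib C A B q) :
    ∃ f : SpecFib C B B q, mul (adj e) e = mul (adj f) f := by
  obtain ⟨x, rfl⟩ := mk_surjective q e
  obtain ⟨y, hy⟩ := C.property.isCStarCat.positive x
  exact ⟨mk q y, congrArg (mk q) hy⟩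

theorem one_mul (e : SpecFib C A B q) : mul (mk q (𝟙 A)) e = e := by
  obtain ⟨x, rfl⟩ := mk_surjective q e
  exact congrArg (mk q) (Category.comp_id _)

theorem mul_one (e : SpecFib C A B q) : mul e (mk q (𝟙 B)) = e := by
  obtain ⟨x, rfl⟩ := mk_surjective q e
  exact congrArg (mk q) (Category.id_comp _)

theorem exists_mk_ne_zero (A B : C.Obj) (q : BaseSpectrum C.toStarCatData) :
    ∃ x : B ⟶ A, mk q x ≠ 0 := by
  obtain ⟨ω, rfl⟩ := BaseSpectrum.mk_surjective q
  obtain ⟨x, hx⟩ := ω.exists_ne_zero B A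
  exact ⟨x, fun h => hx (((mk_eq_mk_iff ω x 0).1 h).trans (map_zero _))⟩

/-- On the quotient by its kernel ω is injective into ℂ, so the ratio of the values of ω is the
required scalar. -/
theorem exists_smul_eq {e : SpecFib C A B q} (he : e ≠ 0) (f : SpecFib C A B q) :
    ∃ c : ℂ, c • e = f := by
  obtain ⟨ω, rfl⟩ := BaseSpectrum.mk_surjective q
  obtain ⟨x, rfl⟩ := mk_surjective _ e
  obtain ⟨y, rfl⟩ := mk_surjective _ f
  have hx : ω.toFun x ≠ 0 := fun h => he ((mk_eq_mk_iff ω x 0).2 (h.trans (map_zero _).symm))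
  refine ⟨ω.toFun y / ω.toFun x, (mk_eq_mk_iff ω _ y).2 ?_⟩
  rw [map_smul, smul_eq_mul, div_mul_cancel₀ _ hx]

theorem finrank_eq_one (A B : C.Obj) (q : BaseSpectrum C.toStarCatData) :
    Module.finrank ℂ (SpecFib C A B q) = 1 := by
  obtain ⟨x, hx⟩ := exists_mk_ne_zero A B q
  exact (finrank_eq_one_iff_of_nonzero' _ hx).2 (exists_smul_eq hx)

theorem completeSpace (A B : C.Obj) (q : BaseSpectrum C.toStarCatData) :
    CompleteSpace (SpecFib C A B q) := by
  have : FiniteDimensional ℂ (SpecFib C A B q) :=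
    Module.finite_of_finrank_pos (by rw [finrank_eq_one]; exact one_pos)
  exact FiniteDimensional.complete ℂ _

theorem dense_span {s : Set (SpecFib C A B q)} {e : SpecFib C A B q} (he : e ≠ 0) (hs : e ∈ s) :
    Dense (Submodule.span ℂ s : Set (SpecFib C A B q)) := by
  refine Dense.mono (s₁ := Set.univ) (fun f _ => ?_) dense_univ
  obtain ⟨c, rfl⟩ := exists_smul_eq he f
  exact Submodule.smul_mem _ c (Submodule.subset_span hs)

/-! ## The topology of the spectral spaceoid -/

/-- The function ω ↦ |ω(x)| is continuous on [C; ℂ] and constant on unitary classes, so it descends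
to the quotient topology. -/
theorem continuous_norm_mk (x : B ⟶ A) :
    Continuous fun q : BaseSpectrum C.toStarCatData => ‖mk q x‖ := by
  refine isQuotientMap_quotient_mk'.continuous_iff.2 ?_
  exact (CFunctor.continuous_eval x).norm.congr fun ω => (norm_mk ω x).symm

/-- The tubes around the single section x̂ form a neighbourhood base at its values. All continuity
statements about Σ(C) reduce to this criterion, since every point of the total space lies on some
x̂. -/
theorem tendsto_tot_iff {ι : Type*} {l : Filter ι} {F : ι → TotalSpace ℂ (SpecFib C A B)}
    (x : B ⟶ A) (q : BaseSpectrum C.toStarCatData) :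
    Tendsto F l (𝓝 ⟨q, mk q x⟩) ↔ Tendsto (fun z => (F z).1) l (𝓝 q) ∧
      Tendsto (fun z => ‖(F z).2 - mk (F z).1 x‖) l (𝓝 0) := by
  constructor
  · intro h
    have h1 : ∀ (U : Set (BaseSpectrum C.toStarCatData)) (ε : ℝ), IsOpen U → q ∈ U → 0 < ε →
        ∀ᶠ z in l, F z ∈ tube x U ε := by
      intro U ε hU hq hε
      refine h (IsOpen.mem_nhds (TopologicalSpace.isOpen_generateFrom_of_mem ⟨x, U, ε, hU, rfl⟩)
        ⟨hq, ?_⟩)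
      rw [sub_self, norm_zero]
      exact hε
    constructor
    · intro V hV
      obtain ⟨U, hUV, hU, hq⟩ := mem_nhds_iff.1 hV
      exact (h1 U 1 hU hq one_pos).mono fun z hz => hUV hz.1
    · rw [Metric.tendsto_nhds]
      intro ε hε
      filter_upwards [h1 Set.univ ε isOpen_univ trivial hε] with z hz
      rw [dist_zero_right, norm_norm]
      exact hz.2
  · rintro ⟨h1, h2⟩
    refine TopologicalSpace.tendsto_nhds_generateFrom_iff.2 ?_
    rintro _ ⟨y, U, ε, hU, rfl⟩ ⟨hq, hε⟩
    have hε : ‖mk q (x - y)‖ < ε := hε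
    -- A tube around another section ŷ that contains the limit point also contains a thin tube
    -- around x̂, by the triangle inequality and continuity of the distance between x̂ and ŷ.
    have h3 : Tendsto (fun z => ‖(F z).2 - mk (F z).1 x‖ + ‖mk (F z).1 (x - y)‖) l
        (𝓝 (0 + ‖mk q (x - y)‖)) :=
      h2.add (((continuous_norm_mk (x - y)).tendsto q).comp h1)
    rw [zero_add] at h3
    filter_upwards [h1 (hU.mem_nhds hq), h3.eventually_lt_const hε] with z hz1 hz2
    refine ⟨hz1, lt_of_le_of_lt ?_ hz2⟩
    rw [mk_sub]
    exact norm_sub_le_norm_sub_add_norm_sub _ _ _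

theorem continuous_norm (A B : C.Obj) :
    Continuous fun e : TotalSpace ℂ (SpecFib C A B) => ‖e.2‖ := by
  rw [continuous_iff_continuousAt]
  rintro ⟨q, e⟩
  obtain ⟨x, rfl⟩ := mk_surjective q e
  obtain ⟨h1, h2⟩ := (tendsto_tot_iff x q).1 tendsto_id
  have h3 : Tendsto (fun e : TotalSpace ℂ (SpecFib C A B) => ‖mk e.1 x‖) (𝓝 ⟨q, mk q x⟩)
      (𝓝 ‖mk q x‖) := ((continuous_norm_mk x).tendsto q).comp h1
  rw [ContinuousAt, tendsto_iff_norm_sub_tendsto_zero]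
  rw [tendsto_iff_norm_sub_tendsto_zero] at h3
  refine squeeze_zero (fun _ => norm_nonneg _) (fun e => ?_) (by simpa using h2.add h3)
  refine (abs_sub_le _ ‖mk e.1 x‖ _).trans (add_le_add_left (abs_norm_sub_norm_le _ _) _)

/-- The section `x̂` trivializes the spectral spaceoid where it does not vanish. -/
theorem exists_smul_mk_eq (x : B ⟶ A) (q : BaseSpectrum C.toStarCatData) :
    ∃ c : SpecFib C A B q →ₗ[ℂ] ℂ, mk q x ≠ 0 → ∀ e, c e • mk q x = e := by
  by_cases h : mk q x = 0
  · exact ⟨0, fun h' => (h' h).elim⟩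
  · refine ⟨(LinearEquiv.ofBijective (LinearMap.toSpanSingleton ℂ _ (mk q x))
      ⟨smul_left_injective ℂ h, exists_smul_eq h⟩).symm.toLinearMap, fun _ e => ?_⟩
    exact (LinearEquiv.ofBijective (LinearMap.toSpanSingleton ℂ _ (mk q x))
      ⟨smul_left_injective ℂ h, exists_smul_eq h⟩).apply_symm_apply e

/-- The coordinate with respect to the section `x̂`. -/
def coord (x : B ⟶ A) (q : BaseSpectrum C.toStarCatData) : SpecFib C A B q →ₗ[ℂ] ℂ :=
  (exists_smul_mk_eq x q).choose

theorem coord_smul {x : B ⟶ A} (h : mk q x ≠ 0) (e : SpecFib C A B q) :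
    coord x q e • mk q x = e := (exists_smul_mk_eq x q).choose_spec h e

theorem coord_smul_mk {x : B ⟶ A} (h : mk q x ≠ 0) (c : ℂ) : coord x q (c • mk q x) = c :=
  smul_left_injective ℂ h (coord_smul h (c • mk q x))

theorem isOpen_ne_zero (x : B ⟶ A) :
    IsOpen {q : BaseSpectrum C.toStarCatData | mk q x ≠ 0} := by
  have : {q : BaseSpectrum C.toStarCatData | mk q x ≠ 0} = {q | ‖mk q x‖ ≠ 0} :=
    Set.ext fun q => norm_ne_zero_iff.symm
  rw [this]
  exact isOpen_ne_fun (continuous_norm_mk x) continuous_const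

theorem continuous_proj (A B : C.Obj) :
    Continuous (TotalSpace.proj : TotalSpace ℂ (SpecFib C A B) → _) := by
  rw [continuous_iff_continuousAt]
  rintro ⟨q, e⟩
  obtain ⟨x, rfl⟩ := mk_surjective q e
  exact ((tendsto_tot_iff x q).1 tendsto_id).1

/-- The local trivialization of the spectral spaceoid given by the section `x̂`. -/
def trivialization (x : B ⟶ A) :
    Trivialization ℂ (TotalSpace.proj : TotalSpace ℂ (SpecFib C A B) → _) where
  toFun e := (e.1, coord x e.1 e.2)
  invFun z := ⟨z.1, z.2 • mk z.1 x⟩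
  source := TotalSpace.proj ⁻¹' {q | mk q x ≠ 0}
  target := {q | mk q x ≠ 0} ×ˢ Set.univ
  map_source' _ he := ⟨he, trivial⟩
  map_target' _ hz := hz.1
  left_inv' e he := congrArg (TotalSpace.mk e.1) (coord_smul he e.2)
  right_inv' z hz := Prod.ext rfl (coord_smul_mk hz.1 z.2)
  open_source := (isOpen_ne_zero x).preimage (continuous_proj A B)
  open_target := (isOpen_ne_zero x).prod isOpen_univ
  continuousOn_toFun := by
    rintro ⟨q, e⟩ hq
    refine ContinuousAt.continuousWithinAt ?_
    refine (continuous_proj A B).continuousAt.prodMk ?_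
    have hq : mk q x ≠ 0 := hq
    -- The point lies on a constant multiple of x̂. Subtracting that multiple and dividing by ‖x̂‖
    -- gives the distance between the coordinates.
    have he : e = mk q (coord x q e • x) := (coord_smul hq e).symm
    have h0 : Tendsto id (𝓝 (⟨q, e⟩ : TotalSpace ℂ (SpecFib C A B)))
        (𝓝 (⟨q, mk q (coord x q e • x)⟩)) := by rw [← he]; exact tendsto_id
    obtain ⟨h1, h2⟩ := (tendsto_tot_iff _ q).1 h0
    have h3 := ((continuous_norm_mk x).tendsto q).comp h1
    have h4 := h2.div h3 (norm_ne_zero_iff.2 hq)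
    rw [zero_div] at h4
    rw [ContinuousAt, tendsto_iff_norm_sub_tendsto_zero]
    refine h4.congr' ?_
    filter_upwards [h1 ((isOpen_ne_zero x).mem_nhds hq)] with f hf
    have hf : mk f.1 x ≠ 0 := hf
    change ‖f.2 - mk f.1 (coord x q e • x)‖ / ‖mk f.1 x‖ = _
    have : f.2 - mk f.1 (coord x q e • x) = (coord x f.1 f.2 - coord x q e) • mk f.1 x := by
      rw [sub_smul, coord_smul hf, mk_smul]
    rw [this, norm_smul, mul_div_cancel_right₀ _ (norm_ne_zero_iff.2 hf)]
  continuousOn_invFun := by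
    refine Continuous.continuousOn (continuous_iff_continuousAt.2 ?_)
    rintro ⟨q, c⟩
    refine (tendsto_tot_iff (c • x) q).2 ⟨continuous_fst.tendsto _, ?_⟩
    have h1 : Continuous fun z : BaseSpectrum C.toStarCatData × ℂ =>
        ‖z.2 - c‖ * ‖mk z.1 x‖ :=
      (continuous_snd.sub continuous_const).norm.mul ((continuous_norm_mk x).comp continuous_fst)
    have h2 := h1.tendsto (q, c)
    simp only [sub_self, norm_zero, zero_mul] at h2
    refine h2.congr fun z => ?_
    rw [mk_smul, ← sub_smul, norm_smul]
  baseSet := {q | mk q x ≠ 0}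
  open_baseSet := isOpen_ne_zero x
  source_eq := rfl
  target_eq := rfl
  proj_toFun _ _ := rfl

theorem trivialization_isLinear (x : B ⟶ A) : (trivialization x).IsLinear ℂ where
  linear p _ := ⟨map_add (coord x p), map_smul (coord x p)⟩

/-- The fibres are one-dimensional, so one nonzero product suffices, and e*e and ee* are nonzero
when e is. -/
theorem saturated (A B : C.Obj) (q : BaseSpectrum C.toStarCatData) :
    Dense (Submodule.span ℂ {z | ∃ e f : SpecFib C A B q, z = mul (adj e) f} :
      Set (SpecFib C B B q)) ∧
    Dense (Submodule.span ℂ {z | ∃ e f : SpecFib C A B q, z = mul e (adj f)} :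
      Set (SpecFib C A A q)) := by
  obtain ⟨x, hx⟩ := exists_mk_ne_zero A B q
  have h1 : ‖mk q x‖ ≠ 0 := norm_ne_zero_iff.2 hx
  constructor
  · refine dense_span (e := mul (adj (mk q x)) (mk q x)) ?_ ⟨_, _, rfl⟩
    rw [← norm_ne_zero_iff, norm_adj_mul]
    exact pow_ne_zero 2 h1
  · refine dense_span (e := mul (mk q x) (adj (mk q x))) ?_ ⟨_, _, rfl⟩
    rw [← norm_ne_zero_iff, norm_mul, norm_adj]
    exact mul_ne_zero h1 h1

/-- Near the values of x̂ and ŷ one has ef - x̂ŷ = (e - x̂)f + x̂(f - ŷ), with ‖x̂‖ ≤ ‖x‖ and ‖f‖ ≤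
‖f - ŷ‖ + ‖y‖. -/
theorem continuous_mul (A B D : C.Obj) :
    Continuous fun z : TotalSpace (ℂ × ℂ) (SpecFib C A B ×ᵇ SpecFib C B D) =>
      (⟨z.1, mul z.2.1 z.2.2⟩ : TotalSpace ℂ (SpecFib C A D)) := by
  have hd := (FiberBundle.Prod.isInducing_diag ℂ (SpecFib C A B) ℂ (SpecFib C B D)).continuous
  rw [continuous_iff_continuousAt]
  rintro ⟨q, e, f⟩
  obtain ⟨x, rfl⟩ := mk_surjective q e
  obtain ⟨y, rfl⟩ := mk_surjective q f
  obtain ⟨h1, h2⟩ := (tendsto_tot_iff x q).1 ((continuous_fst.comp hd).tendsto ⟨q, mk q x, mk q y⟩)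
  obtain ⟨-, h3⟩ := (tendsto_tot_iff y q).1 ((continuous_snd.comp hd).tendsto ⟨q, mk q x, mk q y⟩)
  refine (tendsto_tot_iff (y ≫ x) q).2 ⟨h1, ?_⟩
  have h4 := (h2.mul (h3.add_const ‖y‖)).add (h3.const_mul ‖x‖)
  simp only [zero_mul, mul_zero, zero_add] at h4
  refine squeeze_zero (fun _ => norm_nonneg _) (fun z => ?_) h4
  obtain ⟨p, e, f⟩ := z
  change ‖mul e f - mk p (y ≫ x)‖ ≤
    ‖e - mk p x‖ * (‖f - mk p y‖ + ‖y‖) + ‖x‖ * ‖f - mk p y‖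
  have h5 : mul e f - mk p (y ≫ x) = mul (e - mk p x) f + mul (mk p x) (f - mk p y) := by
    have e1 := add_mul (e - mk p x) (mk p x) f
    have e2 := mul_add (mk p x) (f - mk p y) (mk p y)
    rw [sub_add_cancel] at e1 e2
    rw [← mul_mk, e1, e2]
    abel
  rw [h5]
  refine (norm_add_le _ _).trans (add_le_add ?_ ?_)
  · rw [norm_mul]
    refine mul_le_mul_of_nonneg_left ?_ (norm_nonneg _)
    have h6 := norm_add_le (f - mk p y) (mk p y)
    rw [sub_add_cancel] at h6
    exact h6.trans (add_le_add_right (norm_mk_le y) _)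
  · rw [norm_mul]
    exact mul_le_mul_of_nonneg_right (norm_mk_le x) (norm_nonneg _)

theorem continuous_adj (A B : C.Obj) :
    Continuous fun e : TotalSpace ℂ (SpecFib C A B) =>
      (⟨e.1, adj e.2⟩ : TotalSpace ℂ (SpecFib C B A)) := by
  rw [continuous_iff_continuousAt]
  rintro ⟨q, e⟩
  obtain ⟨x, rfl⟩ := mk_surjective q e
  obtain ⟨h1, h2⟩ := (tendsto_tot_iff x q).1 tendsto_id
  refine (tendsto_tot_iff (C.adj x) q).2 ⟨h1, h2.congr fun z => ?_⟩
  change ‖z.2 - mk z.1 x‖ = ‖adj z.2 - mk z.1 (C.adj x)‖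
  rw [← adj_mk, ← adj_sub, norm_adj]

end SpecFib

theorem specData_isSpaceoid (C : FullCommCStarCat.{u}) : IsSpaceoid (specData C) where
  compact := BaseSpectrum.compactSpace
  hausdorff := BaseSpectrum.t2Space
  nonempty := C.property.nonempty
  rank_one := SpecFib.finrank_eq_one
  locally_trivial A B q := by
    obtain ⟨x, hx⟩ := SpecFib.exists_mk_ne_zero A B q
    exact ⟨SpecFib.trivialization x, hx, SpecFib.trivialization_isLinear x⟩
  complete := SpecFib.completeSpace
  continuous_norm := SpecFib.continuous_norm
  continuous_mul := SpecFib.continuous_mul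
  continuous_adj := SpecFib.continuous_adj
  add_mul := SpecFib.add_mul
  mul_add := SpecFib.mul_add
  smul_mul := SpecFib.smul_mul
  mul_smul := SpecFib.mul_smul
  mul_assoc := SpecFib.mul_assoc
  norm_mul_le e f := (SpecFib.norm_mul e f).le
  adj_add := SpecFib.adj_add
  adj_smul := SpecFib.adj_smul
  adj_adj := SpecFib.adj_adj
  adj_mul := SpecFib.adj_mul
  norm_adj_mul := SpecFib.norm_adj_mul
  positive := SpecFib.positive
  one_mul := SpecFib.one_mul
  mul_one := SpecFib.mul_one
  saturated := SpecFib.saturated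

/-! ## `Σ` is a functor -/

/-- Morphisms of spaceoids are equal if they agree on enough sections. -/
theorem SpaceoidHomData.ext_of_sections {E₁ E₂ : SpaceoidData.{u}} {f g : SpaceoidHomData E₁ E₂}
    (hb : ∀ p, f.base p = g.base p) (hi : ∀ A, f.ind.symm A = g.ind.symm A)
    (hf : ∀ (A B : E₂.Ind) (p : E₁.Base) (v : E₂.Fib A B (f.base p)),
      ∃ σ : ∀ q, E₂.Fib A B q, σ (f.base p) = v ∧
        HEq (f.fib A B p (σ (f.base p))) (g.fib A B p (σ (g.base p)))) : f = g := by
  obtain ⟨b, i, F⟩ := f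
  obtain ⟨b', i', F'⟩ := g
  -- The fibre maps have the same type only after the base and index maps have been identified;
  -- until then they are compared by `HEq`.
  obtain rfl : b = b' := funext hb
  obtain rfl : i = i' := by
    rw [← Equiv.symm_symm i, ← Equiv.symm_symm i']
    exact congrArg Equiv.symm (Equiv.ext hi)
  congr 1
  funext A B p
  refine LinearMap.ext fun v => ?_
  obtain ⟨σ, rfl, h⟩ := hf A B p v
  exact eq_of_heq h

/-- Morphisms into a spectral spaceoid are equal if they agree on the sections `x̂`. -/
theorem SpaceoidHomData.ext_of_mk {E : SpaceoidData.{u}} {C : FullCommCStarCat.{u}}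
    {f g : SpaceoidHomData E (specData C)}
    (hb : ∀ p, f.base p = g.base p) (hi : ∀ A, f.ind.symm A = g.ind.symm A)
    (hf : ∀ (A B : C.Obj) (p : E.Base) (x : B ⟶ A),
      HEq (f.fib A B p (SpecFib.mk (f.base p) x)) (g.fib A B p (SpecFib.mk (g.base p) x))) :
    f = g :=
  SpaceoidHomData.ext_of_sections hb hi fun A B p v => by
    obtain ⟨x, hx⟩ := SpecFib.mk_surjective _ v
    exact ⟨fun q => SpecFib.mk q x, hx, hf A B p x⟩

section Functoriality

variable {C D : FullCommCStarCat.{u}} (Φ : C ⟶ D)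

theorem continuous_baseMap : Continuous (baseMap Φ) := by
  refine Continuous.quotient_map' ?_ _
  refine continuous_iInf_rng.2 fun A => continuous_iInf_rng.2 fun B =>
    continuous_iInf_rng.2 fun x => continuous_induced_rng.2 ?_
  exact CFunctor.continuous_eval (Φ.functor.map x)

/-- The map `Λ^Φ : x + I_{λ^Φ([ω]_{AB})} ↦ Φ(x) + I_{[ω]_{AB}}` between fibres. -/
def specFibMap (A B : C.Obj) (q : BaseSpectrum D.toStarCatData) :
    SpecFib C A B (baseMap Φ q) →ₗ[ℂ] SpecFib D (Φ.functor.obj A) (Φ.functor.obj B) q :=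
  (specHomData Φ).fib A B q

/-- Both norms equal |ω(Φ(x))|. Being isometric on fibres and sending x̂ to the section of Φ(x), the
fibre map is continuous by the convergence criterion. -/
theorem norm_specFibMap (A B : C.Obj) (q : BaseSpectrum D.toStarCatData)
    (e : SpecFib C A B (baseMap Φ q)) : ‖specFibMap Φ A B q e‖ = ‖e‖ := by
  obtain ⟨ω, rfl⟩ := BaseSpectrum.mk_surjective q
  obtain ⟨x, rfl⟩ := SpecFib.mk_surjective _ e
  exact (SpecFib.norm_mk ω (Φ.functor.map x)).trans (SpecFib.norm_mk (ω.comp Φ) x).symm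

theorem continuous_specFibMap (A B : C.Obj) :
    Continuous fun z : TotalSpace ℂ (baseMap Φ *ᵖ (SpecFib C A B)) =>
      (⟨z.1, specFibMap Φ A B z.1 z.2⟩ :
        TotalSpace ℂ (SpecFib D (Φ.functor.obj A) (Φ.functor.obj B))) := by
  rw [continuous_iff_continuousAt]
  rintro ⟨q, e⟩
  obtain ⟨x, rfl⟩ := SpecFib.mk_surjective (baseMap Φ q) e
  have hl := (Pullback.continuous_lift ℂ (SpecFib C A B) (baseMap Φ)).tendsto
    ⟨q, SpecFib.mk (baseMap Φ q) x⟩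
  have h2 := ((SpecFib.tendsto_tot_iff x (baseMap Φ q)).1 hl).2
  refine (SpecFib.tendsto_tot_iff (Φ.functor.map x) q).2
    ⟨(Pullback.continuous_proj ℂ (SpecFib C A B) (baseMap Φ)).tendsto _, h2.congr fun z => ?_⟩
  refine (norm_specFibMap Φ A B z.1 _).symm.trans (congrArg norm ?_)
  exact LinearMap.map_sub (specFibMap Φ A B z.1) z.2 (SpecFib.mk (baseMap Φ z.1) x)

theorem specHomData_isSpaceoidHom : IsSpaceoidHom (specHomData Φ) where
  continuous_base := continuous_baseMap Φ
  continuous_fib := continuous_specFibMap Φ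
  fib_mul A B K q e f := by
    obtain ⟨x, rfl⟩ := SpecFib.mk_surjective _ e
    obtain ⟨y, rfl⟩ := SpecFib.mk_surjective _ f
    exact congrArg (SpecFib.mk q) (Φ.functor.map_comp y x)
  fib_adj A B q e := by
    obtain ⟨x, rfl⟩ := SpecFib.mk_surjective _ e
    exact congrArg (SpecFib.mk q) (Φ.property.map_adj x)
  fib_one A q := congrArg (SpecFib.mk q) (Φ.functor.map_id A)

end Functoriality

theorem sigmaIsFunctor : SigmaIsFunctor.{u} where
  obj := specData_isSpaceoid
  map := specHomData_isSpaceoidHom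
  map_id C := SpaceoidHomData.ext_of_mk
    (fun q => by obtain ⟨ω, rfl⟩ := BaseSpectrum.mk_surjective q; rfl)
    (fun _ => rfl) (fun _ _ _ _ => HEq.rfl)
  map_comp Φ Ψ := SpaceoidHomData.ext_of_mk
    (fun q => by obtain ⟨ω, rfl⟩ := BaseSpectrum.mk_surjective q; rfl)
    (fun _ => rfl) (fun _ _ _ _ => HEq.rfl)

/-! ## The Gel'fand transform -/

section Gelfand

variable (C : FullCommCStarCat.{u}) (h : IsSpaceoid (specData C)) {A B : C.Obj}

/-- By the C*-identity it suffices to bound the characters of C_{BB} on x*x. Each extends to some ω,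
and there the value is |ω(x)|² = ‖x + I_{[ω]}‖². -/
theorem norm_gelfandTransform_map (x : B ⟶ A) : ‖(gelfandTransform C h).map x‖ = ‖x‖ := by
  have hC := C.property.isCStarCat
  apply le_antisymm
  · exact Sec.norm_le (σ := gelfandMap C h x) (norm_nonneg x) fun q => SpecFib.norm_mk_le (q := q) x
  · refine le_of_sq_le_sq ?_ (norm_nonneg _)
    rw [← hC.norm_comp_adj]
    refine norm_le_of_char (C := C) (sq_nonneg _) fun χ => ?_
    obtain ⟨ω, hω⟩ := exists_cfunctor_extending χ
    rw [← hω, ω.apply_comp_adj, Complex.norm_real, norm_pow, norm_norm, ← SpecFib.norm_mk]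
    exact pow_le_pow_left₀ (norm_nonneg _)
      (Sec.norm_apply_le (gelfandMap C h x) (BaseSpectrum.mk ω)) 2

theorem gelfandTransform_map_injective :
    Function.Injective fun x : B ⟶ A => (gelfandTransform C h).map x := by
  intro x y hxy
  have h1 : (gelfandTransform C h).map (x - y) =
      (gelfandTransform C h).map x - (gelfandTransform C h).map y := rfl
  have hxy : (gelfandTransform C h).map x = (gelfandTransform C h).map y := hxy
  rw [← sub_eq_zero, ← norm_eq_zero, ← norm_gelfandTransform_map C h, h1, hxy, sub_self, norm_zero]

variable {C} in
/-- Continuous functions on the base spectrum come from endomorphisms. -/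
theorem exists_mk_eq_smul_mk_id (B : C.Obj) {f : BaseSpectrum C.toStarCatData → ℂ}
    (hf : Continuous f) : ∃ b : B ⟶ B, ∀ q, SpecFib.mk q b = f q • SpecFib.mk q (𝟙 B) := by
  obtain ⟨b, hb⟩ := exists_char_eq (C := C) (A := B)
    ⟨fun χ => f ((BaseSpectrum.homeoChar B).symm χ),
      hf.comp (BaseSpectrum.homeoChar B).symm.continuous⟩
  refine ⟨b, fun q => ?_⟩
  have h1 := (hb (BaseSpectrum.homeoChar B q)).trans
    (congrArg f ((BaseSpectrum.homeoChar B).symm_apply_apply q))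
  obtain ⟨ω, rfl⟩ := BaseSpectrum.mk_surjective q
  rw [← SpecFib.mk_smul, SpecFib.mk_eq_mk_iff, map_smul, ω.map_id, smul_eq_mul, mul_one]
  exact h1

/-- Finitely many x̂ have no common zero, so a section is a finite sum Σ f_x x̂. Each f_x is the
transform of an endomorphism b_x of B, and the section is the transform of Σ x b_x. -/
theorem gelfandTransform_map_surjective :
    Function.Surjective fun x : B ⟶ A => (gelfandTransform C h).map x := by
  intro σ
  obtain ⟨t, ht⟩ := exists_finset_ne_zero h (s := fun (x : B ⟶ A) q => SpecFib.mk q x)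
    (fun x => (gelfandMap C h x).2) (SpecFib.exists_mk_ne_zero A B)
  obtain ⟨f, hf, hσ⟩ := exists_eq_sum_smul h (s := fun (x : B ⟶ A) q => SpecFib.mk q x)
    (fun x => (gelfandMap C h x).2) ht (Subtype.property (p := fun σ => IsContSection
      (E := specData C) (A := A) (B := B) σ) σ)
  choose b hb using fun x => exists_mk_eq_smul_mk_id B (hf x)
  refine ⟨∑ x ∈ t, b x ≫ x, Sec.ext fun (q : BaseSpectrum C.toStarCatData) =>
    Eq.trans ?_ (hσ q).symm⟩
  refine (map_sum (Submodule.mkQ (idealAt q A B)) _ t).trans (Finset.sum_congr rfl fun x _ => ?_)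
  change SpecFib.mk q (b x ≫ x) = f x q • SpecFib.mk q x
  rw [← SpecFib.mul_mk, hb, SpecFib.mul_smul, SpecFib.mul_one]

end Gelfand

/-- The spectral spaceoid. -/
def specSpaceoid (C : FullCommCStarCat.{u}) : Spaceoid.{u} :=
  ⟨specData C, specData_isSpaceoid C⟩

/-- The C*-category of sections. -/
def secCat (E : Spaceoid.{u}) : FullCommCStarCat.{u} :=
  ⟨secData E, secData_isFullCommCStarCat E⟩

/-- The Gel'fand transform, as a morphism. -/
def gelfandHom (C : FullCommCStarCat.{u}) : C ⟶ secCat (specSpaceoid C) :=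
  ⟨gelfandTransform C (specData_isSpaceoid C),
    { map_add := fun _ _ => rfl
      map_smul := fun _ _ => rfl
      map_adj := fun _ => rfl
      bijective := Function.bijective_id }⟩

/-- The Gel'fand transform on the hom-sets. -/
def gelfandLinearEquiv (C : FullCommCStarCat.{u}) (A B : C.Obj) :
    (B ⟶ A) ≃ₗ[ℂ] ((gelfandTransform C (specData_isSpaceoid C)).obj B ⟶
      (gelfandTransform C (specData_isSpaceoid C)).obj A) :=
  LinearEquiv.ofBijective
    { toFun := fun x => (gelfandTransform C (specData_isSpaceoid C)).map x
      map_add' := fun _ _ => rfl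
      map_smul' := fun _ _ => rfl }
    ⟨gelfandTransform_map_injective C _, gelfandTransform_map_surjective C _⟩

/-- The Gel'fand transform on the hom-sets, as a bijection. -/
def gelfandMapEquiv (C : FullCommCStarCat.{u}) (A B : C.Obj) :
    (B ⟶ A) ≃ Sec (specSpaceoid C) A B := (gelfandLinearEquiv C A B).toEquiv

theorem gelfandMapEquiv_symm_add (C : FullCommCStarCat.{u}) {A B : C.Obj}
    (σ τ : (gelfandTransform C (specData_isSpaceoid C)).obj B ⟶
      (gelfandTransform C (specData_isSpaceoid C)).obj A) :
    (gelfandMapEquiv C A B).symm (σ + τ) =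
      (gelfandMapEquiv C A B).symm σ + (gelfandMapEquiv C A B).symm τ :=
  (gelfandLinearEquiv C A B).symm.map_add σ τ

theorem gelfandMapEquiv_symm_smul (C : FullCommCStarCat.{u}) {A B : C.Obj} (c : ℂ)
    (σ : (gelfandTransform C (specData_isSpaceoid C)).obj B ⟶
      (gelfandTransform C (specData_isSpaceoid C)).obj A) :
    (gelfandMapEquiv C A B).symm (c • σ) = c • (gelfandMapEquiv C A B).symm σ :=
  (gelfandLinearEquiv C A B).symm.map_smul c σ

/-- The inverse of the Gel'fand transform. -/
def gelfandInv (C : FullCommCStarCat.{u}) : secCat (specSpaceoid C) ⟶ C :=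
  ⟨{ obj := fun A => A
     map := fun {B A} σ => (gelfandMapEquiv C A B).symm σ
     map_id := fun A => (gelfandMapEquiv C A A).symm_apply_eq.2 rfl
     map_comp := fun {K B A} ρ σ => (gelfandMapEquiv C A K).symm_apply_eq.2
      (congrArg₂ (fun (ρ : K ⟶ B) (σ : B ⟶ A) => ρ ≫ σ)
        ((gelfandMapEquiv C B K).apply_symm_apply ρ).symm
        ((gelfandMapEquiv C A B).apply_symm_apply σ).symm) },
   { map_add := fun σ τ => gelfandMapEquiv_symm_add C σ τ
     map_smul := fun c σ => gelfandMapEquiv_symm_smul C c σ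
     map_adj := fun {B A} σ => (gelfandMapEquiv C B A).symm_apply_eq.2
      (congrArg (secData (specSpaceoid C)).adj ((gelfandMapEquiv C A B).apply_symm_apply σ).symm)
     bijective := Function.bijective_id }⟩

/-- The Gel'fand transform is an isomorphism. -/
def gelfandIso (C : FullCommCStarCat.{u}) : C ≅ secCat (specSpaceoid C) where
  hom := gelfandHom C
  inv := gelfandInv C
  hom_inv_id := ObjBijStarFunctor.ext (Functor.hext (fun _ => rfl) fun B A x =>
    heq_of_eq ((gelfandMapEquiv C A B).symm_apply_apply x))
  inv_hom_id := ObjBijStarFunctor.ext (Functor.hext (fun _ => rfl) fun B A x =>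
    heq_of_eq ((gelfandMapEquiv C A B).apply_symm_apply x))

/-! ## Functors on the fibres over a point -/

section FibreFunctors

variable {E : SpaceoidData.{u}} (hE : IsSpaceoid E)

include hE

theorem exists_norm_eq_one (A B : E.Ind) (p : E.Base) : ∃ e : E.Fib A B p, ‖e‖ = 1 := by
  have := hE.nontrivial A B p
  obtain ⟨v, hv⟩ := exists_ne (0 : E.Fib A B p)
  have hv' := norm_ne_zero_iff.2 hv
  exact ⟨((‖v‖⁻¹ : ℝ) : ℂ) • v, by
    rw [norm_smul, Complex.norm_real, norm_inv, norm_norm, inv_mul_cancel₀ hv']⟩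

theorem IsSpaceoid.adj_mul_self_of_norm {A B : E.Ind} {p : E.Base} {e : E.Fib A B p}
    (he : ‖e‖ = 1) : E.mul (E.adj e) e = E.one B p := by
  rw [← hE.coef_smul_one (E.mul (E.adj e) e), hE.coef_adj_mul_self, he]
  simp

theorem IsSpaceoid.mul_adj_self_of_norm {A B : E.Ind} {p : E.Base} {e : E.Fib A B p}
    (he : ‖e‖ = 1) : E.mul e (E.adj e) = E.one A p := by
  rw [← hE.coef_smul_one (E.mul e (E.adj e)), hE.coef_mul_adj_self, he]
  simp

/-- Unit vectors v_A ∈ E_{AO} over p are unitary, so e ↦ v_A* e v_B maps every fibre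
multiplicatively into E_{OO}, which is ℂ. -/
theorem nonempty_fibreFunctor (p : E.Base) : Nonempty (FibreFunctor E p) := by
  obtain ⟨O⟩ := hE.nonempty
  choose v hv using fun A => exists_norm_eq_one hE A O p
  exact ⟨{
    toFun := fun {A B} =>
      { toFun := fun e => hE.coef (E.mul (E.adj (v A)) (E.mul e (v B)))
        map_add' := fun e f => by rw [hE.add_mul, hE.mul_add, map_add]
        map_smul' := fun c e => by rw [hE.smul_mul, hE.mul_smul, map_smul]; rfl }
    map_one := fun A => by
      change hE.coef (E.mul (E.adj (v A)) (E.mul (E.one A p) (v A))) = 1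
      rw [hE.one_mul, hE.adj_mul_self_of_norm (hv A), hE.coef_one]
    map_mul := fun {A B D} e f => by
      change hE.coef (E.mul (E.adj (v A)) (E.mul (E.mul e f) (v D))) =
        hE.coef (E.mul (E.adj (v A)) (E.mul e (v B))) *
          hE.coef (E.mul (E.adj (v B)) (E.mul f (v D)))
      rw [← hE.coef_mul, hE.mul_assoc (E.adj (v A)), hE.mul_assoc e (v B),
        ← hE.mul_assoc (v B), hE.mul_adj_self_of_norm (hv B), hE.one_mul, hE.mul_assoc e f]
    map_adj := fun {A B} e => by
      change hE.coef (E.mul (E.adj (v B)) (E.mul (E.adj e) (v A))) =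
        conj (hE.coef (E.mul (E.adj (v A)) (E.mul e (v B))))
      rw [← hE.coef_adj, hE.adj_mul, hE.adj_mul, hE.adj_adj, hE.mul_assoc] }⟩

/-- On diagonal fibres γ is forced by unitality. Hence [γ ∘ ev_p] is independent of γ, by the
criterion for unitary equivalence on a single object. -/
theorem FibreFunctor.apply_eq_coef {p : E.Base} (γ : FibreFunctor E p) {A : E.Ind}
    (e : E.Fib A A p) : γ.toFun e = hE.coef e := by
  conv_lhs => rw [← hE.coef_smul_one e, map_smul, γ.map_one, smul_eq_mul, mul_one]

theorem FibreFunctor.norm_apply {p : E.Base} (γ : FibreFunctor E p) {A B : E.Ind}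
    (e : E.Fib A B p) : ‖γ.toFun e‖ = ‖e‖ := by
  have h1 := γ.map_mul (E.adj e) e
  rw [γ.apply_eq_coef hE, hE.coef_adj_mul_self, γ.map_adj, ← Complex.normSq_eq_conj_mul_self,
    Complex.normSq_eq_norm_sq, Complex.ofReal_inj] at h1
  exact ((sq_eq_sq₀ (norm_nonneg _) (norm_nonneg _)).1 h1).symm

end FibreFunctors

/-! ## The evaluation transform -/

section Evaluation

/-- An index, as an object of the C*-category of sections. -/
def objOf {E : Spaceoid.{u}} (A : E.Ind) : (secCat E).Obj := A

/-- A section, as an arrow of the C*-category of sections. -/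
def Sec.toHom {E : Spaceoid.{u}} {A B : E.Ind} (σ : Sec E A B) :
    (objOf B : (secCat E).Obj) ⟶ objOf A := σ

variable (E : Spaceoid.{u})

/-- The class `η_Δ(p) = [γ ∘ ev_p]`. -/
def evalClass (p : E.Base) : BaseSpectrum (secCat E).toStarCatData :=
  BaseSpectrum.mk (C := secCat E) (evalFunctor E p (nonempty_fibreFunctor E.property p).some)

/-- The evaluation of arrows at a point. -/
def evalHom (A B : E.Ind) (p : E.Base) :
    ((objOf B : (secCat E).Obj) ⟶ objOf A) →ₗ[ℂ] E.Fib A B p where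
  toFun σ := Sec.evalAt E A B p σ
  map_add' _ _ := rfl
  map_smul' _ _ := rfl

variable {E}

/-- The class `σ + I_{[ω]_{AB}}` of a section. -/
def mkSec {A B : E.Ind} (q : BaseSpectrum (secCat E).toStarCatData) (σ : Sec E A B) :
    SpecFib (secCat E) (objOf A) (objOf B) q := SpecFib.mk q σ.toHom

theorem mkSec_surjective (A B : E.Ind) (q : BaseSpectrum (secCat E).toStarCatData) :
    Function.Surjective (mkSec (A := A) (B := B) q) := SpecFib.mk_surjective q

theorem evalClass_eq {p : E.Base} (γ : FibreFunctor E.toSpaceoidData p) :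
    evalClass E p = BaseSpectrum.mk (C := secCat E) (evalFunctor E p γ) := by
  obtain ⟨O⟩ := E.property.nonempty
  refine BaseSpectrum.mk_eq_of_eq_on (C := secCat E) O fun σ => ?_
  exact (FibreFunctor.apply_eq_coef E.property _ _).trans (γ.apply_eq_coef E.property _).symm

theorem toChar_evalClass (p : E.Base) {O : E.Ind} (σ : Sec E O O) :
    BaseSpectrum.toChar (objOf O) (evalClass E p) (of σ.toHom) = E.property.coef (σ.1 p) :=
  FibreFunctor.apply_eq_coef E.property _ _

/-- Seen in the spectrum of Γ(E)_{OO}, the map sends p to the character σ ↦ coefficient of σ_p,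
which is continuous in p. -/
theorem continuous_evalClass : Continuous (evalClass E) := by
  obtain ⟨O⟩ := E.property.nonempty
  rw [← (BaseSpectrum.homeoChar (C := secCat E) (objOf O)).comp_continuous_iff]
  refine continuous_induced_rng.2 ?_
  refine WeakDual.continuous_of_continuous_eval fun σ => ?_
  refine (IsContSection.continuous_coef E.property (Subtype.property (p := fun σ => IsContSection
    (E := E.toSpaceoidData) (A := O) (B := O) σ) σ)).congr fun p => ?_
  exact (toChar_evalClass (O := O) p σ).symm

/-- The section `f 1` for a continuous function `f`. -/
def scalarSec (O : E.Ind) (f : C(E.Base, ℂ)) : Sec E O O :=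
  Sec.ofCont (fun p => f p • E.one O p)
    (IsContSection.smul_fun E.property f.continuous (IsContSection.one E.property))

theorem coef_scalarSec (O : E.Ind) (f : C(E.Base, ℂ)) (p : E.Base) :
    E.property.coef ((scalarSec O f).1 p) = f p := by
  change E.property.coef (f p • E.one O p) = f p
  rw [map_smul, E.property.coef_one, smul_eq_mul, mul_one]

theorem sec_ext_coef {O : E.Ind} {σ τ : Sec E O O}
    (h : ∀ p, E.property.coef (σ.1 p) = E.property.coef (τ.1 p)) : σ = τ :=
  Sec.ext fun p => E.property.coef_injective (h p)

theorem scalarSec_coef {O : E.Ind} (σ : Sec E O O) :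
    scalarSec O ⟨_, IsContSection.continuous_coef E.property σ.2⟩ = σ :=
  sec_ext_coef fun p => coef_scalarSec O _ p

theorem scalarSec_add (O : E.Ind) (f g : C(E.Base, ℂ)) :
    (scalarSec O (f + g)).toHom = (scalarSec O f).toHom + (scalarSec O g).toHom :=
  Sec.ext (A := O) (B := O) fun _ => add_smul _ _ _

theorem scalarSec_smul (O : E.Ind) (c : ℂ) (f : C(E.Base, ℂ)) :
    (scalarSec O (c • f)).toHom = c • (scalarSec O f).toHom :=
  Sec.ext (A := O) (B := O) fun p => smul_assoc c (f p) (E.one O p)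

theorem scalarSec_mul (O : E.Ind) (f g : C(E.Base, ℂ)) :
    (scalarSec O (f * g)).toHom = (scalarSec O g).toHom ≫ (scalarSec O f).toHom :=
  sec_ext_coef (O := O) fun p => by
    refine Eq.trans ?_ (E.property.coef_mul _ _).symm
    refine (coef_scalarSec O _ p).trans ?_
    exact (congrArg₂ (· * ·) (coef_scalarSec O f p) (coef_scalarSec O g p)).symm

theorem scalarSec_one (O : E.Ind) : (scalarSec O (1 : C(E.Base, ℂ))).toHom = 𝟙 (objOf O) :=
  Sec.ext (A := O) (B := O) fun _ => one_smul _ _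

/-- The restriction of a `ℂ`-valued *-functor on `Γ(E)` to a character of `C(X)`. -/
def scalarChar (O : E.Ind) (ω : CFunctor (secCat E).toStarCatData) : C(E.Base, ℂ) →ₐ[ℂ] ℂ :=
  AlgHom.ofLinearMap
    { toFun := fun f => ω.toFun (scalarSec O f).toHom
      map_add' := fun f g => by rw [scalarSec_add, map_add]
      map_smul' := fun c f => by rw [scalarSec_smul, map_smul]; rfl }
    ((congrArg _ (scalarSec_one O)).trans (ω.map_id _))
    (fun f g => (congrArg _ (scalarSec_mul O f g)).trans (ω.map_comp _ _))

/-- The algebra Γ(E)_{OO} consists of the sections f 1 with f ∈ C(X), and the characters of C(X) are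
exactly the evaluations at points of X. -/
theorem evalClass_bijective : Function.Bijective (evalClass E) := by
  have := E.property.compact
  have := E.property.hausdorff
  obtain ⟨O⟩ := E.property.nonempty
  obtain ⟨hinj, hsurj⟩ := CharacterSpace.continuousMapEval_bijective E.Base ℂ
  constructor
  · intro p p' h
    refine hinj (CharacterSpace.ext fun f => ?_)
    change f p = f p'
    rw [← coef_scalarSec O, ← coef_scalarSec O, ← toChar_evalClass, ← toChar_evalClass, h]
  · intro q
    obtain ⟨ω, rfl⟩ := BaseSpectrum.mk_surjective (C := secCat E) q
    obtain ⟨p, hp⟩ := hsurj (CharacterSpace.equivAlgHom.symm (scalarChar O ω))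
    have hp' : ∀ f : C(E.Base, ℂ), f p = ω.toFun (scalarSec O f).toHom :=
      fun f => DFunLike.congr_fun hp f
    refine ⟨p, BaseSpectrum.mk_eq_of_eq_on (C := secCat E) (objOf O) fun σ => ?_⟩
    have h1 := hp' ⟨_, IsContSection.continuous_coef E.property
      (Subtype.property (p := fun σ => IsContSection
        (E := E.toSpaceoidData) (A := O) (B := O) σ) σ)⟩
    rw [scalarSec_coef (O := O) σ] at h1
    exact (FibreFunctor.apply_eq_coef E.property _ _).trans h1

variable (E) in
/-- The homeomorphism `η_Δ`. -/
def evalHomeo : E.Base ≃ₜ BaseSpectrum (secCat E).toStarCatData :=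
  have := E.property.compact
  have := BaseSpectrum.t2Space (C := secCat E)
  Continuous.homeoOfEquivCompactToT2 (f := Equiv.ofBijective _ evalClass_bijective)
    continuous_evalClass

theorem evalClass_evalHomeo_symm (q : BaseSpectrum (secCat E).toStarCatData) :
    evalClass E ((evalHomeo E).symm q) = q := (evalHomeo E).apply_symm_apply q

theorem norm_mkSec (p : E.Base) {A B : E.Ind} (σ : Sec E A B) :
    ‖mkSec (evalClass E p) σ‖ = ‖σ.1 p‖ :=
  (SpecFib.norm_mk (C := secCat E) _ σ.toHom).trans
    (FibreFunctor.norm_apply E.property _ (σ.1 p))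

theorem mkSec_eq_zero_iff (p : E.Base) {A B : E.Ind} (σ : Sec E A B) :
    mkSec (evalClass E p) σ = 0 ↔ σ.1 p = 0 := by
  rw [← norm_eq_zero, norm_mkSec, norm_eq_zero]

/-- The map `σ + I_{η(p_{AB})} ↦ σ_p`. -/
def fibMap {p : E.Base} {q : BaseSpectrum (secCat E).toStarCatData} (h : evalClass E p = q)
    (A B : E.Ind) : SpecFib (secCat E) (objOf A) (objOf B) q →ₗ[ℂ] E.Fib A B p :=
  Submodule.liftQ (idealAt q (objOf A) (objOf B)) (evalHom E A B p) (by
    subst h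
    exact fun σ hσ => (mkSec_eq_zero_iff p σ).1 ((Submodule.Quotient.mk_eq_zero _).2 hσ))

/-- The point `q` is a variable with an equation `evalClass E p = q`, since the inverse transform
needs the case where `p` is the preimage of `q` and this equation is not definitional. -/
theorem norm_fibMap {p : E.Base} {q : BaseSpectrum (secCat E).toStarCatData}
    (h : evalClass E p = q) (A B : E.Ind) (e : SpecFib (secCat E) (objOf A) (objOf B) q) :
    ‖fibMap h A B e‖ = ‖e‖ := by
  subst h
  obtain ⟨σ, rfl⟩ := mkSec_surjective A B _ e
  exact (norm_mkSec p σ).symm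

theorem fibMap_bijective {p : E.Base} {q : BaseSpectrum (secCat E).toStarCatData}
    (h : evalClass E p = q) (A B : E.Ind) : Function.Bijective (fibMap h A B) := by
  constructor
  · refine (injective_iff_map_eq_zero _).2 fun e he => ?_
    rw [← norm_eq_zero, ← norm_fibMap h A B, he, norm_zero]
  · intro v
    obtain ⟨σ, hσ⟩ := Sec.evalAt_surjective p v
    exact ⟨mkSec q σ, hσ⟩

/-- The isomorphism `σ + I_{η(p_{AB})} ↦ σ_p`. -/
def fibEquiv {p : E.Base} {q : BaseSpectrum (secCat E).toStarCatData} (h : evalClass E p = q)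
    (A B : E.Ind) : SpecFib (secCat E) (objOf A) (objOf B) q ≃ₗ[ℂ] E.Fib A B p :=
  LinearEquiv.ofBijective (fibMap h A B) (fibMap_bijective h A B)

theorem fibEquiv_symm_apply {p : E.Base} {q : BaseSpectrum (secCat E).toStarCatData}
    (h : evalClass E p = q) {A B : E.Ind} (σ : Sec E A B) :
    (fibEquiv h A B).symm (σ.1 p) = mkSec q σ :=
  (fibEquiv h A B).symm_apply_eq.2 rfl

theorem norm_fibEquiv_symm {p : E.Base} {q : BaseSpectrum (secCat E).toStarCatData}
    (h : evalClass E p = q) (A B : E.Ind) (v : E.Fib A B p) :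
    ‖(fibEquiv h A B).symm v‖ = ‖v‖ := by
  rw [← norm_fibMap h]
  exact congrArg norm ((fibEquiv h A B).apply_symm_apply v)

variable (E)

/-- The evaluation transform `(η, Ω)`. -/
def evaluationData : SpaceoidHomData E.toSpaceoidData (specData (secCat E)) where
  base := evalClass E
  ind := Equiv.refl _
  fib := fun A B p => fibMap (E := E) (p := p) rfl A B

/-- The inverse of the evaluation transform. -/
def evaluationInvData : SpaceoidHomData (specData (secCat E)) E.toSpaceoidData where
  base := (evalHomeo E).symm
  ind := Equiv.refl _
  fib := fun A B (q : BaseSpectrum (secCat E).toStarCatData) =>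
    (fibEquiv (E := E) (evalClass_evalHomeo_symm q) A B).symm.toLinearMap

theorem continuous_evaluationData_fib (A B : E.Ind) :
    Continuous fun z : TotalSpace ℂ (evalClass E *ᵖ (SpecFib (secCat E) (objOf A) (objOf B))) =>
      (⟨z.1, fibMap (E := E) (p := z.1) rfl A B z.2⟩ : E.Tot A B) := by
  rw [continuous_iff_continuousAt]
  rintro ⟨p, e⟩
  obtain ⟨σ, rfl⟩ := mkSec_surjective A B (evalClass E p) e
  have hl := (Pullback.continuous_lift ℂ (SpecFib (secCat E) (objOf A) (objOf B))
    (evalClass E)).tendsto ⟨p, mkSec (evalClass E p) σ⟩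
  have h2 := ((SpecFib.tendsto_tot_iff σ.toHom (evalClass E p)).1 hl).2
  refine (tendsto_tot_iff E.property σ.2 p).2
    ⟨(Pullback.continuous_proj ℂ (SpecFib (secCat E) (objOf A) (objOf B)) (evalClass E)).tendsto _,
      h2.congr fun z => ?_⟩
  refine (norm_fibMap (p := z.1) rfl A B _).symm.trans (congrArg norm ?_)
  exact LinearMap.map_sub (fibMap (E := E) (p := z.1) rfl A B) z.2 (mkSec (evalClass E z.1) σ)

/-- The inverse fibre maps are isometric and send the values of a section σ to the values of its
Gel'fand transform, so the two convergence criteria correspond. -/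
theorem continuous_evaluationInvData_fib (A B : E.Ind) :
    Continuous fun z : TotalSpace ℂ ((evalHomeo E).symm *ᵖ (E.Fib A B)) =>
      (⟨z.1, (fibEquiv (E := E) (evalClass_evalHomeo_symm z.1) A B).symm z.2⟩ :
        TotalSpace ℂ (SpecFib (secCat E) (objOf A) (objOf B))) := by
  rw [continuous_iff_continuousAt]
  rintro ⟨q, e⟩
  obtain ⟨σ, rfl⟩ := Sec.evalAt_surjective ((evalHomeo E).symm q) e
  have hl := (Pullback.continuous_lift ℂ (E.Fib A B) (evalHomeo E).symm).tendsto
    ⟨q, σ.1 ((evalHomeo E).symm q)⟩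
  have h2 := ((tendsto_tot_iff E.property σ.2 ((evalHomeo E).symm q)).1 hl).2
  change Tendsto _ _ (𝓝 (TotalSpace.mk q ((fibEquiv (E := E)
    (evalClass_evalHomeo_symm q) A B).symm (σ.1 ((evalHomeo E).symm q)))))
  rw [fibEquiv_symm_apply]
  refine (SpecFib.tendsto_tot_iff σ.toHom q).2
    ⟨(Pullback.continuous_proj ℂ (E.Fib A B) (evalHomeo E).symm).tendsto _, h2.congr fun z => ?_⟩
  refine (norm_fibEquiv_symm (E := E) (evalClass_evalHomeo_symm z.1) A B _).symm.trans
    (congrArg norm ?_)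
  refine (LinearMap.map_sub
    (fibEquiv (E := E) (evalClass_evalHomeo_symm z.1) A B).symm.toLinearMap _ _).trans ?_
  exact congrArg (_ - ·) (fibEquiv_symm_apply (E := E) (evalClass_evalHomeo_symm z.1) σ)

theorem evaluationData_isSpaceoidHom : IsSpaceoidHom (evaluationData E) where
  continuous_base := continuous_evalClass
  continuous_fib := continuous_evaluationData_fib E
  fib_mul A B D p e f := by
    obtain ⟨σ, rfl⟩ := mkSec_surjective A B _ e
    obtain ⟨τ, rfl⟩ := mkSec_surjective B D _ f
    rfl
  fib_adj A B p e := by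
    obtain ⟨σ, rfl⟩ := mkSec_surjective A B _ e
    rfl
  fib_one A p := rfl

theorem evaluationInvData_fib_apply (A B : E.Ind) (q : BaseSpectrum (secCat E).toStarCatData)
    (σ : Sec E A B) :
    (evaluationInvData E).fib A B q (σ.1 ((evalHomeo E).symm q)) = mkSec q σ :=
  fibEquiv_symm_apply _ σ

theorem evaluationInvData_isSpaceoidHom : IsSpaceoidHom (evaluationInvData E) where
  continuous_base := (evalHomeo E).symm.continuous
  continuous_fib := continuous_evaluationInvData_fib E
  fib_mul A B D q e f := by
    obtain ⟨σ, rfl⟩ := Sec.evalAt_surjective _ e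
    obtain ⟨τ, rfl⟩ := Sec.evalAt_surjective _ f
    let ρ : Sec E A D := Sec.ofCont _ (σ.2.mul E.property τ.2)
    refine (evaluationInvData_fib_apply E A D q ρ).trans ?_
    exact (congrArg₂ SpecFib.mul (evaluationInvData_fib_apply E A B q σ)
      (evaluationInvData_fib_apply E B D q τ)).symm
  fib_adj A B q e := by
    obtain ⟨σ, rfl⟩ := Sec.evalAt_surjective _ e
    let ρ : Sec E B A := Sec.ofCont _ (σ.2.adj E.property)
    refine (evaluationInvData_fib_apply E B A q ρ).trans ?_
    exact (congrArg SpecFib.adj (evaluationInvData_fib_apply E A B q σ)).symm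
  fib_one A q := evaluationInvData_fib_apply E A A q
    (Sec.ofCont _ (IsContSection.one E.property))

/-- The evaluation transform is an isomorphism. -/
def evaluationIso : E ≅ specSpaceoid (secCat E) where
  hom := ⟨evaluationData E, evaluationData_isSpaceoidHom E⟩
  inv := ⟨evaluationInvData E, evaluationInvData_isSpaceoidHom E⟩
  hom_inv_id := SpaceoidHom.ext <| SpaceoidHomData.ext_of_sections
    (fun p => (evalHomeo E).symm_apply_apply p) (fun _ => rfl) fun A B p v => by
      -- Writing the vector as the value of a section avoids transport along η⁻¹(η(p)) = p: the
      -- inverse sends it to the class of σ, and Ω sends that class to σ_p.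
      obtain ⟨σ, rfl⟩ := Sec.evalAt_surjective _ v
      refine ⟨σ.1, rfl, heq_of_eq ?_⟩
      exact congrArg (fibMap (E := E) (p := p) rfl A B)
        (evaluationInvData_fib_apply E A B (evalClass E p) σ)
  inv_hom_id := SpaceoidHom.ext <| SpaceoidHomData.ext_of_mk
    (fun q => (evalHomeo E).apply_symm_apply q) (fun _ => rfl) fun A B q σ => heq_of_eq
      (evaluationInvData_fib_apply E A B q σ)

theorem evaluationData_isEvaluationTransform :
    IsEvaluationTransform E (secData_isFullCommCStarCat E) (evaluationData E) where
  ind_apply _ := rfl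
  exists_fibreFunctor := nonempty_fibreFunctor E.property
  base_apply _ γ := evalClass_eq γ
  fib_apply _ _ _ _ := rfl

end Evaluation

/-! ## The duality -/

/-- Both composites send x to the section [ω] ↦ Φ(x) + I_{[ω]}, by definition. -/
theorem gelfandHom_naturality {C D : FullCommCStarCat.{u}} (Φ : C ⟶ D) :
    Φ ≫ gelfandHom D = gelfandHom C ≫ (GammaFunctor gammaIsFunctor).map
      ((SigmaFunctor sigmaIsFunctor).map Φ.op).op :=
  rfl

/-- The functor on the fibres over `f_Δ(p)` induced by a morphism of spaceoids. -/
def FibreFunctor.pullback {E₁ E₂ : Spaceoid.{u}} (f : E₁ ⟶ E₂) {p : E₁.Base}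
    (γ : FibreFunctor E₁.toSpaceoidData p) : FibreFunctor E₂.toSpaceoidData (f.data.base p) where
  toFun := fun {A B} => γ.toFun.comp (f.data.fib A B p)
  map_one A := (congrArg γ.toFun (f.property.fib_one A p)).trans (γ.map_one _)
  map_mul e e' := (congrArg γ.toFun (f.property.fib_mul _ _ _ p e e')).trans (γ.map_mul _ _)
  map_adj e := (congrArg γ.toFun (f.property.fib_adj _ _ p e)).trans (γ.map_adj _)

/-- On base points, composing a γ over p with 𝓕 gives a functor over f_Δ(p). It may differ from the
chosen one there, but its class is the same. -/
theorem evaluation_naturality {E₁ E₂ : Spaceoid.{u}} (f : E₁ ⟶ E₂) :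
    f ≫ (evaluationIso E₂).hom = (evaluationIso E₁).hom ≫ (SigmaFunctor sigmaIsFunctor).map
      ((GammaFunctor gammaIsFunctor).map f.op).op :=
  SpaceoidHom.ext <| SpaceoidHomData.ext_of_mk
    (fun p => evalClass_eq
      (FibreFunctor.pullback f (nonempty_fibreFunctor E₁.property p).some))
    (fun _ => rfl) fun _ _ _ _ => HEq.rfl

/-- The linear form `x + I_{[ω]_{AB}} ↦ ω(x)`. -/
def CFunctor.liftFib {C : FullCommCStarCat.{u}} (ω : CFunctor C.toStarCatData) (A B : C.Obj) :
    SpecFib C A B (BaseSpectrum.mk ω) →ₗ[ℂ] ℂ :=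
  Submodule.liftQ (idealAt (BaseSpectrum.mk ω) A B) (ω.toFun : (B ⟶ A) →ₗ[ℂ] ℂ) (fun _ hx => hx)

/-- A `ℂ`-valued *-functor induces a functor on the fibres of the spectral spaceoid over its
class. -/
def fibreFunctorOfCFunctor {C : FullCommCStarCat.{u}} (ω : CFunctor C.toStarCatData) :
    FibreFunctor (specData C) (BaseSpectrum.mk ω) where
  toFun := fun {A B} => ω.liftFib A B
  map_one A := ω.map_id A
  map_mul e f := by
    obtain ⟨x, rfl⟩ := SpecFib.mk_surjective _ e
    obtain ⟨y, rfl⟩ := SpecFib.mk_surjective _ f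
    exact ω.map_comp y x
  map_adj e := by
    obtain ⟨x, rfl⟩ := SpecFib.mk_surjective _ e
    exact ω.map_adj x

/-- Over [ω] the functor γ may be taken to be the one induced by ω itself; evaluating x̂ at [ω] and
applying γ then returns ω(x). -/
theorem evaluation_comp_gelfand (C : FullCommCStarCat.{u}) :
    (evaluationIso (specSpaceoid C)).hom ≫
      (SigmaFunctor sigmaIsFunctor).map (gelfandHom C).op = 𝟙 (specSpaceoid C) :=
  SpaceoidHom.ext <| SpaceoidHomData.ext_of_mk
    (fun q => by
      obtain ⟨ω, rfl⟩ := BaseSpectrum.mk_surjective q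
      exact congrArg (baseMap (gelfandHom C))
        (evalClass_eq (E := specSpaceoid C) (fibreFunctorOfCFunctor ω)))
    (fun _ => rfl) fun _ _ _ _ => HEq.rfl

/-- The transform of σ has the value σ + I at η(p), which Ω sends to σ_p; all of this holds by
definition. -/
theorem gelfand_comp_evaluation (E : Spaceoid.{u}) :
    gelfandHom (secCat E) ≫ (GammaFunctor gammaIsFunctor).map (evaluationIso E).hom.op =
      𝟙 (secCat E) :=
  rfl

/-- The Gel'fand transforms form a natural isomorphism. -/
def gelfandNatIso : 𝟭 FullCommCStarCat.{u} ≅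
    (SigmaFunctor sigmaIsFunctor).rightOp ⋙ GammaFunctor gammaIsFunctor :=
  NatIso.ofComponents gelfandIso gelfandHom_naturality

/-- The evaluation transforms form a natural isomorphism. -/
def evaluationNatIso : 𝟭 Spaceoid.{u} ≅
    (GammaFunctor gammaIsFunctor).rightOp ⋙ SigmaFunctor sigmaIsFunctor :=
  NatIso.ofComponents evaluationIso evaluation_naturality

end

end GelfandSpaceoid

theorem mainTheorem1 :
    ∃ (hG : GammaIsFunctor.{u}) (hS : SigmaIsFunctor.{u})
      (G : 𝟭 FullCommCStarCat.{u} ≅ (SigmaFunctor hS).rightOp ⋙ GammaFunctor hG)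
      (V : 𝟭 Spaceoid.{u} ≅ (GammaFunctor hG).rightOp ⋙ SigmaFunctor hS),
      (∀ C : FullCommCStarCat.{u},
        (G.hom.app C).functor = gelfandTransform C (hS.obj C)) ∧
      (∀ (C : FullCommCStarCat.{u}) (A B : C.Obj),
        (∀ x : A ⟶ B, ‖(gelfandTransform C (hS.obj C)).map x‖ = ‖x‖) ∧
        Function.Surjective fun x : A ⟶ B => (gelfandTransform C (hS.obj C)).map x) ∧
      (∀ E : Spaceoid.{u}, IsEvaluationTransform E (hG.obj E) (V.hom.app E).data) ∧
      (∀ E : Spaceoid.{u},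
        G.hom.app ((GammaFunctor hG).obj (op E)) ≫ (GammaFunctor hG).map (V.hom.app E).op =
          𝟙 ((GammaFunctor hG).obj (op E))) ∧
      (∀ C : FullCommCStarCat.{u},
        V.hom.app ((SigmaFunctor hS).obj (op C)) ≫ (SigmaFunctor hS).map (G.hom.app C).op =
          𝟙 ((SigmaFunctor hS).obj (op C))) := by
  refine ⟨gammaIsFunctor, sigmaIsFunctor, gelfandNatIso, evaluationNatIso, fun _ => rfl,
    fun C A B => ⟨norm_gelfandTransform_map C _, gelfandTransform_map_surjective C _⟩,
    evaluationData_isEvaluationTransform, gelfand_comp_evaluation, evaluation_comp_gelfand⟩
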